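/- Let $\mathfrak g$ be a finite-dimensional real Lie algebra with basis indexed by $A=1,\dots,N$ and structure constants $f_{AB}{}^C$, let $\lambda$ be a formal parameter, and let $U_\lambda$ be the enveloping algebra over $\mathbb R[[\lambda]]$ with generators $\hat z_A$ and relations $[\hat z_A,\hat z_B]=\lambda\sum_C f_{AB}{}^C\hat z_C$. Let $Z_A=\sum_B\psi_A{}^B(\zeta)\,\partial/\partial\zeta^B$ be the corresponding left-invariant vector fields in coordinates $\zeta$ on the group that vanish at the identity: $[Z_A,Z_B]=\lambda\sum_C f_{AB}{}^CZ_C$, $\psi_A{}^B(0)=\delta_A^B$, $\psi_A{}^B|_{\lambda=0}=\delta_A^B$, where each $\psi_A{}^B$ is a formal power series in $\lambda$ with coefficients polynomial in $\zeta$. For $\hat f\in U_\lambda$ let $\Omega(\hat f)$ be obtained by substituting $\hat z_A\mapsto Z_A=\sum_B\psi_A{}^B(\zeta)z_B$, moving all $\zeta$'s to the left by means of $z_B\zeta^A=\delta_B^A+\zeta^Az_B$, and setting $\zeta=0$; it is a series in $\lambda$ with polynomial coefficients in the commuting variables $z_1,\dots,z_N$. The star product of polynomials is $f\star g=\Omega(\Omega^{-1}(f)\,\Omega^{-1}(g))$.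 At each order in $\lambda$ it is a bidifferential operator with polynomial coefficients; applying these operators to smooth functions, and extending $\lambda$-bilinearly, one obtains the star product $f\star g$ of formal power series $f,g$ in $\lambda$ whose coefficients are smooth (real- or complex-valued) functions on $\mathbb R^N$. Writing $\hat f=\Omega^{-1}(f)$, so that $\hat f\hat g=\Omega^{-1}(f\star g)$, define the invariant integral by $\oint\hat f=\int_{\mathbb R^N}f(z)\,d^Nz$, order by order in $\lambda$. Suppose that the adjoint representation of $\mathfrak g$ is traceless, i.e. $c_A=\sum_Bf_{AB}{}^B=0$ for all $A$. Let $f=\sum_m\lambda^mf_m$ and $g=\sum_n\lambda^ng_n$ have smooth coefficients such that $p\,(\partial^\alpha f_m)(\partial^\beta g_n)$ is Lebesgue integrable on $\mathbb R^N$ for all $m,n$, all multi-indices $\alpha,\beta$ and all polynomials $p$ (for instance, all $f_m,g_n$ are Schwartz functions, or all $g_n$ have compact support). Then all coefficients of $f\star g$ and of $g\star f$ are integrable, and $$\oint\hat f\hat g=\oint\hat g\hat f,\qquad\text{i.e.}\qquad\int_{\mathbb R^N}f\star g=\int_{\mathbb R^N}g\star f .$$ -/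

import Mathlib

namespace LieStar

noncomputable section

set_option linter.unusedSectionVars false

variable {ι : Type*} [Fintype ι] [DecidableEq ι]
variable {𝔤 : Type*} [LieRing 𝔤] [LieAlgebra ℝ 𝔤]

/-- The structure constants `f_{AB}^C` of a real Lie algebra in a basis:
`⁅b A, b B⁆ = ∑ C, f_{AB}^C • b C`. -/
def structureConst (b : Module.Basis ι ℝ 𝔤) (A B C : ι) : ℝ :=
  b.repr ⁅b A, b B⁆ C

/-- The constants `c_A = ∑ B, f_{AB}^B` (the traces of the adjoint representation). -/
def adTrace (b : Module.Basis ι ℝ 𝔤) (A : ι) : ℝ :=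
  ∑ B, structureConst b A B B

/-! ### The enveloping algebra with the formal parameter -/

/-- The relations `ẑ_A ẑ_B = ẑ_B ẑ_A + λ ∑ C, f_{AB}^C ẑ_C`; the formal parameter `λ` is the
variable of the ring `ℝ⟦λ⟧` of scalars. -/
inductive EnvRel (b : Module.Basis ι ℝ 𝔤) :
    FreeAlgebra (PowerSeries ℝ) ι → FreeAlgebra (PowerSeries ℝ) ι → Prop
  | comm (A B : ι) : EnvRel b
      (FreeAlgebra.ι (PowerSeries ℝ) A * FreeAlgebra.ι (PowerSeries ℝ) B)
      (FreeAlgebra.ι (PowerSeries ℝ) B * FreeAlgebra.ι (PowerSeries ℝ) A +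
        ∑ C, (PowerSeries.X * PowerSeries.C (structureConst b A B C) : PowerSeries ℝ) •
          FreeAlgebra.ι (PowerSeries ℝ) C)

/-- The universal enveloping algebra over `ℝ⟦λ⟧` of the Lie algebra with generators `ẑ_A` and
commutation relations `[ẑ_A, ẑ_B] = λ ∑ C, f_{AB}^C ẑ_C`. -/
abbrev EnvAlg (b : Module.Basis ι ℝ 𝔤) : Type _ := RingQuot (EnvRel b)

/-! ### Left-invariant vector fields in coordinates -/

/-- The partial derivative `∂/∂x_B`, applied to every coefficient of a series in `λ` whose
coefficients are polynomials in the variables `x`. -/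
def coeffDeriv {σ : Type*} (B : σ) (F : PowerSeries (MvPolynomial σ ℝ)) :
    PowerSeries (MvPolynomial σ ℝ) :=
  PowerSeries.mk fun n => MvPolynomial.pderiv B (PowerSeries.coeff n F)

/-- The left-invariant vector fields `Z_A = ∑ B, ψ_A^B(ζ) ∂/∂ζ^B` belonging to the generators
`ẑ_A`, expressed in coordinates `ζ` on the group manifold that vanish at the identity.
The functions `ψ_A^B` are formal series in `λ`; at each order in `λ` they are polynomials
in `ζ`, which is what makes the star product of two arbitrary smooth functions well defined. -/
structure LeftInvariantFrame (b : Module.Basis ι ℝ 𝔤) where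
  /-- The components `ψ_A^B`. -/
  ψ : ι → ι → PowerSeries (MvPolynomial ι ℝ)
  /-- At the identity `ζ = 0` of the group, `Z_A` is `∂/∂ζ^A`. -/
  counit : ∀ A B, PowerSeries.map (MvPolynomial.constantCoeff (R := ℝ) (σ := ι)) (ψ A B) =
    if A = B then 1 else 0
  /-- In the abelian limit `λ = 0`, `Z_A` is `∂/∂ζ^A`. -/
  limit : ∀ A B, PowerSeries.constantCoeff (ψ A B) = if A = B then 1 else 0
  /-- The vector fields satisfy `[Z_A, Z_B] = λ ∑ C, f_{AB}^C Z_C`. -/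
  bracket : ∀ A B D,
    ∑ C, (ψ A C * coeffDeriv C (ψ B D) - ψ B C * coeffDeriv C (ψ A D)) =
      ∑ C, PowerSeries.X * PowerSeries.C (MvPolynomial.C (structureConst b A B C)) * ψ C D

/-! ### Normally ordered expressions in `ζ` and `z = ∂/∂ζ` -/

/-- Normally ordered expressions `∑ i, F_i(ζ) G_i(z)`, with all `ζ`'s to the left of all `z`'s:
series in `λ` with polynomial coefficients in the variables `ζ^A` (`Sum.inl A`) and
`z_A` (`Sum.inr A`). -/
abbrev NormalOrdered (ι : Type*) : Type _ := PowerSeries (MvPolynomial (ι ⊕ ι) ℝ)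

/-- A function of `ζ`, regarded as a normally ordered expression. -/
def zetaFun : PowerSeries (MvPolynomial ι ℝ) →+* NormalOrdered ι :=
  PowerSeries.map (MvPolynomial.rename (R := ℝ) (Sum.inl : ι → ι ⊕ ι)).toRingHom

theorem coeffDeriv_add {σ : Type*} (B : σ) (F G : PowerSeries (MvPolynomial σ ℝ)) :
    coeffDeriv B (F + G) = coeffDeriv B F + coeffDeriv B G := by
  ext1 n; simp [coeffDeriv]

theorem coeffDeriv_mul {σ : Type*} (B : σ) (F G : PowerSeries (MvPolynomial σ ℝ)) :
    coeffDeriv B (F * G) = coeffDeriv B F * G + F * coeffDeriv B G := by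
  ext1 n
  simp only [coeffDeriv, PowerSeries.coeff_mk, PowerSeries.coeff_mul, map_sum, map_add,
    Derivation.leibniz, smul_eq_mul, ← Finset.sum_add_distrib]
  refine Finset.sum_congr rfl fun x _ => ?_
  ring

theorem coeffDeriv_scalar {σ : Type*} (B : σ) (r : PowerSeries ℝ) :
    coeffDeriv B (algebraMap (PowerSeries ℝ) (PowerSeries (MvPolynomial σ ℝ)) r) = 0 := by
  ext1 n
  simp [coeffDeriv, PowerSeries.algebraMap_apply'', MvPolynomial.algebraMap_eq]

theorem coeffDeriv_smul {σ : Type*} (B : σ) (r : PowerSeries ℝ)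
    (F : PowerSeries (MvPolynomial σ ℝ)) : coeffDeriv B (r • F) = r • coeffDeriv B F := by
  rw [Algebra.smul_def, coeffDeriv_mul, coeffDeriv_scalar, Algebra.smul_def]
  ring

theorem coeffDeriv_comm {σ : Type*} (B C : σ) (F : PowerSeries (MvPolynomial σ ℝ)) :
    coeffDeriv B (coeffDeriv C F) = coeffDeriv C (coeffDeriv B F) := by
  ext1 n
  simp only [coeffDeriv, PowerSeries.coeff_mk]
  have h : ⁅(MvPolynomial.pderiv B : Derivation ℝ (MvPolynomial σ ℝ) (MvPolynomial σ ℝ)),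
      (MvPolynomial.pderiv C : Derivation ℝ (MvPolynomial σ ℝ) (MvPolynomial σ ℝ))⁆ = 0 := by
    apply MvPolynomial.derivation_ext
    intro i
    classical
    simp [Derivation.commutator_apply, MvPolynomial.pderiv_X, Pi.single_apply, apply_ite]
  have := congrArg (fun D : Derivation ℝ (MvPolynomial σ ℝ) (MvPolynomial σ ℝ) =>
    D (PowerSeries.coeff n F)) h
  simpa [Derivation.commutator_apply, sub_eq_zero] using this

/-- Left multiplication of a normally ordered expression by `z_B`, brought to normal order by
means of `z_B ζ^A = δ_B^A + ζ^A z_B`:  `z_B F(ζ, z) = ∂F/∂ζ^B + F(ζ, z) z_B`. -/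
def zMul (B : ι) : NormalOrdered ι →ₗ[PowerSeries ℝ] NormalOrdered ι where
  toFun F := coeffDeriv (Sum.inl B) F + F * PowerSeries.C (MvPolynomial.X (Sum.inr B))
  map_add' F G := by rw [coeffDeriv_add]; ring
  map_smul' r F := by
    rw [coeffDeriv_smul, RingHom.id_apply, smul_add, smul_mul_assoc]

theorem zMul_apply (B : ι) (F : NormalOrdered ι) :
    zMul B F = coeffDeriv (Sum.inl B) F + F * PowerSeries.C (MvPolynomial.X (Sum.inr B)) := rfl

theorem zMul_comm (B C : ι) (F : NormalOrdered ι) : zMul B (zMul C F) = zMul C (zMul B F) := by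
  have h : ∀ B C : ι, coeffDeriv (Sum.inl B)
      (PowerSeries.C (MvPolynomial.X (Sum.inr C)) : NormalOrdered ι) = 0 := by
    intro B C
    classical
    ext1 n
    simp only [coeffDeriv, PowerSeries.coeff_mk, PowerSeries.coeff_C]
    split_ifs <;> simp [MvPolynomial.pderiv_X]
  simp only [zMul_apply, coeffDeriv_add, coeffDeriv_mul, h]
  rw [coeffDeriv_comm]
  ring

theorem coeffDeriv_zetaFun (B : ι) (p : PowerSeries (MvPolynomial ι ℝ)) :
    coeffDeriv (Sum.inl B) (zetaFun p) = zetaFun (coeffDeriv B p) := by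
  ext1 n
  simp [coeffDeriv, zetaFun, MvPolynomial.pderiv_rename Sum.inl_injective]

theorem zMul_mul (B : ι) (p : PowerSeries (MvPolynomial ι ℝ)) (F : NormalOrdered ι) :
    zMul B (zetaFun p * F) = zetaFun (coeffDeriv B p) * F + zetaFun p * zMul B F := by
  simp only [zMul_apply, coeffDeriv_mul, coeffDeriv_zetaFun]
  ring

variable {b : Module.Basis ι ℝ 𝔤}

/-- Left multiplication of a normally ordered expression by `Z_A = ∑ B, ψ_A^B(ζ) z_B`, brought
to normal order. -/
def fieldMul (Z : LeftInvariantFrame b) (A : ι) :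
    Module.End (PowerSeries ℝ) (NormalOrdered ι) :=
  ∑ B, LinearMap.mulLeft (PowerSeries ℝ) (zetaFun (Z.ψ A B)) ∘ₗ zMul B

theorem fieldMul_apply (Z : LeftInvariantFrame b) (A : ι) (F : NormalOrdered ι) :
    fieldMul Z A F = ∑ B, zetaFun (Z.ψ A B) * zMul B F := by
  simp [fieldMul, LinearMap.sum_apply]

theorem fieldMul_comm (Z : LeftInvariantFrame b) (A B : ι) :
    fieldMul Z A * fieldMul Z B = fieldMul Z B * fieldMul Z A +
      ∑ C, (PowerSeries.X * PowerSeries.C (structureConst b A B C) : PowerSeries ℝ) •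
        fieldMul Z C := by
  have key : ∀ (A B : ι) (F : NormalOrdered ι), fieldMul Z A (fieldMul Z B F) =
      ∑ D, zetaFun (∑ C, Z.ψ A C * coeffDeriv C (Z.ψ B D)) * zMul D F +
        ∑ C, ∑ D, zetaFun (Z.ψ A C) * (zetaFun (Z.ψ B D) * zMul C (zMul D F)) := by
    intro A B F
    have h1 : ∀ C, zetaFun (Z.ψ A C) * zMul C (fieldMul Z B F) =
        ∑ D, zetaFun (Z.ψ A C) * zetaFun (coeffDeriv C (Z.ψ B D)) * zMul D F +
          ∑ D, zetaFun (Z.ψ A C) * (zetaFun (Z.ψ B D) * zMul C (zMul D F)) := by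
      intro C
      rw [fieldMul_apply, map_sum, Finset.mul_sum, ← Finset.sum_add_distrib]
      refine Finset.sum_congr rfl fun D _ => ?_
      rw [zMul_mul, mul_add, mul_assoc]
    rw [fieldMul_apply, Finset.sum_congr rfl fun C _ => h1 C, Finset.sum_add_distrib,
      Finset.sum_comm]
    congr 1
    refine Finset.sum_congr rfl fun D _ => ?_
    rw [map_sum, Finset.sum_mul]
    refine Finset.sum_congr rfl fun C _ => ?_
    rw [map_mul]
  have sc : ∀ (c : ℝ) (F : NormalOrdered ι),
      (PowerSeries.X * PowerSeries.C c : PowerSeries ℝ) • F =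
        zetaFun (PowerSeries.X * PowerSeries.C (MvPolynomial.C c)) * F := by
    intro c F
    rw [Algebra.smul_def, PowerSeries.algebraMap_apply'']
    simp [zetaFun, MvPolynomial.algebraMap_eq]
  have sym : ∀ F : NormalOrdered ι,
      ∑ C, ∑ D, zetaFun (Z.ψ A C) * (zetaFun (Z.ψ B D) * zMul C (zMul D F)) =
        ∑ C, ∑ D, zetaFun (Z.ψ B C) * (zetaFun (Z.ψ A D) * zMul C (zMul D F)) := by
    intro F
    rw [Finset.sum_comm]
    refine Finset.sum_congr rfl fun C _ => Finset.sum_congr rfl fun D _ => ?_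
    rw [zMul_comm D C]
    ring
  refine LinearMap.ext fun F => ?_
  have hb : ∀ D, zetaFun (∑ C, Z.ψ A C * coeffDeriv C (Z.ψ B D)) =
      zetaFun (∑ C, Z.ψ B C * coeffDeriv C (Z.ψ A D)) +
        ∑ C, zetaFun (PowerSeries.X * PowerSeries.C (MvPolynomial.C (structureConst b A B C))) *
          zetaFun (Z.ψ C D) := by
    intro D
    have h := congrArg zetaFun (Z.bracket A B D)
    rw [Finset.sum_sub_distrib, map_sub, sub_eq_iff_eq_add'] at h
    rw [h]
    refine congrArg _ ?_
    rw [map_sum]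
    refine Finset.sum_congr rfl fun C _ => ?_
    rw [map_mul]
  have h2 : ∑ D, (∑ C, zetaFun (PowerSeries.X * PowerSeries.C
        (MvPolynomial.C (structureConst b A B C))) * zetaFun (Z.ψ C D)) * zMul D F =
      ∑ C, (PowerSeries.X * PowerSeries.C (structureConst b A B C) : PowerSeries ℝ) •
        fieldMul Z C F := by
    simp only [sc, fieldMul_apply, Finset.sum_mul, Finset.mul_sum]
    rw [Finset.sum_comm]
    simp only [mul_assoc]
  have h3 : (∑ C, (PowerSeries.X * PowerSeries.C (structureConst b A B C) : PowerSeries ℝ) •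
      fieldMul Z C) F = ∑ C, (PowerSeries.X * PowerSeries.C (structureConst b A B C) :
        PowerSeries ℝ) • fieldMul Z C F := by
    rw [LinearMap.sum_apply]; rfl
  rw [Module.End.mul_apply, LinearMap.add_apply, Module.End.mul_apply, h3, key, key, sym F, ← h2,
    add_right_comm]
  refine congrArg (· + _) ?_
  rw [← Finset.sum_add_distrib]
  refine Finset.sum_congr rfl fun D _ => ?_
  rw [hb, add_mul]

/-- The substitution `f̂(ẑ) ↦ f̂(Z)`, where `f̂(Z)` acts by left multiplication on normally
ordered expressions. -/
def substZ (Z : LeftInvariantFrame b) :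
    EnvAlg b →ₐ[PowerSeries ℝ] Module.End (PowerSeries ℝ) (NormalOrdered ι) :=
  RingQuot.liftAlgHom (PowerSeries ℝ)
    ⟨FreeAlgebra.lift (PowerSeries ℝ) (fieldMul Z), by
      intro x y h
      induction h with
      | comm A B =>
        rw [map_mul, map_add, map_mul, map_sum]
        simp only [map_smul, FreeAlgebra.lift_ι_apply]
        exact fieldMul_comm Z A B⟩

/-- The map `ω`: set `ζ = 0` in a normally ordered expression. -/
def setZetaZero : NormalOrdered ι →+* PowerSeries (MvPolynomial ι ℝ) :=
  PowerSeries.map (MvPolynomial.aeval (R := ℝ)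
    (Sum.elim (fun _ : ι => (0 : MvPolynomial ι ℝ)) MvPolynomial.X)).toRingHom

/-- The map `Ω(f̂(ẑ)) = ω(f̂(Z))`: write `f̂(Z)` in normal order and set `ζ = 0`. The result is a
series in `λ` with polynomial coefficients in the commuting variables `z_A`. -/
def Omega (Z : LeftInvariantFrame b) (u : EnvAlg b) : PowerSeries (MvPolynomial ι ℝ) :=
  setZetaZero (substZ Z u 1)

/-- `f̂ = Ω⁻¹(f)` for a polynomial `f` in the commuting variables `z_A`. -/
def OmegaInv (Z : LeftInvariantFrame b) (p : MvPolynomial ι ℝ) : EnvAlg b :=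
  Function.invFun (Omega Z) (PowerSeries.C p)

/-- The star product `f ⋆ g = Ω(f̂ ĝ)` of two polynomials. -/
def polyStar (Z : LeftInvariantFrame b) (p q : MvPolynomial ι ℝ) :
    PowerSeries (MvPolynomial ι ℝ) :=
  Omega Z (OmegaInv Z p * OmegaInv Z q)

/-! ### The star product of formal series of smooth functions

At each order in `λ` the star product of polynomials is a bidifferential operator with polynomial
coefficients, and this operator is applied to smooth functions. Concretely, the value at `z` of
`f ⋆ g` is the value at `z` of the star product of the Taylor expansions of `f` and `g` at `z`. -/

section Smooth

variable {𝕜 : Type*} [RCLike 𝕜]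

/-- The partial derivative `∂f/∂z_A`. -/
def partialDeriv (A : ι) (f : (ι → ℝ) → 𝕜) : (ι → ℝ) → 𝕜 :=
  fun z => fderiv ℝ f z (Pi.single A 1)

/-- The iterated partial derivative `∂_{A₁} ⋯ ∂_{Aₙ} f`. -/
def iterPartial (I : List ι) (f : (ι → ℝ) → 𝕜) : (ι → ℝ) → 𝕜 :=
  I.foldr partialDeriv f

/-- The polynomial `w ↦ (w_{A₁} - z_{A₁}) ⋯ (w_{Aₙ} - z_{Aₙ})`. -/
def shiftedMonomial (z : ι → ℝ) (I : List ι) : MvPolynomial ι ℝ :=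
  (I.map fun A => MvPolynomial.X A - MvPolynomial.C (z A)).prod

/-- The part of order `λ ^ k` of the star product of two smooth functions:
`∑_{m,n} 1/(m! n!) ∑_{I,J} ∂_I f(z) ∂_J g(z) ((w - z)^I ⋆ (w - z)^J)_k (w = z)`, where `I`, `J`
run over the index sequences of lengths `m`, `n` (a finite sum). -/
def bidiff (Z : LeftInvariantFrame b) (k : ℕ) (f g : (ι → ℝ) → 𝕜) : (ι → ℝ) → 𝕜 := fun z =>
  ∑ᶠ mn : ℕ × ℕ, ∑ I : Fin mn.1 → ι, ∑ J : Fin mn.2 → ι,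
    ((mn.1.factorial : ℝ)⁻¹ * (mn.2.factorial : ℝ)⁻¹ *
      MvPolynomial.eval z (PowerSeries.coeff k
        (polyStar Z (shiftedMonomial z (List.ofFn I)) (shiftedMonomial z (List.ofFn J))))) •
      (iterPartial (List.ofFn I) f z * iterPartial (List.ofFn J) g z)

/-- The star product of two formal series in `λ` whose coefficients are functions on `ℝ^N`:
the `λ`-bilinear extension of the star product of smooth functions. -/
def star (Z : LeftInvariantFrame b) (f g : PowerSeries ((ι → ℝ) → 𝕜)) :
    PowerSeries ((ι → ℝ) → 𝕜) :=
  PowerSeries.mk fun n => ∑ x ∈ Finset.HasAntidiagonal.antidiagonal n, ∑ y ∈ Finset.HasAntidiagonal.antidiagonal x.2,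
    bidiff Z x.1 (PowerSeries.coeff y.1 f) (PowerSeries.coeff y.2 g)

/-- All coefficients of the formal series are `C^∞` functions on `ℝ^N`. -/
def IsSmooth (f : PowerSeries ((ι → ℝ) → 𝕜)) : Prop :=
  ∀ n, ContDiff ℝ ((⊤ : ℕ∞) : WithTop ℕ∞) (PowerSeries.coeff n f)

/-- Every product of a polynomial, a partial derivative (of any order) of a coefficient of `f`,
and a partial derivative (of any order) of a coefficient of `g` is Lebesgue integrable. -/
def JointlyIntegrable (f g : PowerSeries ((ι → ℝ) → 𝕜)) : Prop :=
  ∀ (m n : ℕ) (I J : List ι) (p : MvPolynomial ι ℝ),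
    MeasureTheory.Integrable (fun z : ι → ℝ => MvPolynomial.eval z p •
      (iterPartial I (PowerSeries.coeff m f) z * iterPartial J (PowerSeries.coeff n g) z))

/-- The invariant integral of `f̂`, `f = Ω(f̂)`: the integral `∫ f(z) d^N z`, taken order by order
in `λ`. -/
def invIntegral (f : PowerSeries ((ι → ℝ) → 𝕜)) : PowerSeries 𝕜 :=
  PowerSeries.mk fun n => ∫ z : ι → ℝ, PowerSeries.coeff n f z

/-- The integral of a formal series exists: every coefficient is Lebesgue integrable. -/
def IsIntegrable (f : PowerSeries ((ι → ℝ) → 𝕜)) : Prop :=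
  ∀ n, MeasureTheory.Integrable (PowerSeries.coeff n f : (ι → ℝ) → 𝕜)

end Smooth

end

end LieStar

/-! The star commutator with a fixed polynomial `q` is, at each order in `λ`, a total divergence `∑
∂_A S_A`, where each `S_A` is a differential operator. Everything rests on this algebraic fact
(`IsLieStar.commutator_totalDiv`); the analysis is only integration by parts.

For a generator: `f̂(Z) Z_A = ∑ (f̂(Z) ψ_A^B(ζ)) z_B`. After `ζ = 0`, a `ζ` standing on the right
acts as `∂/∂z`, so right multiplication by `z_A` has the form `∑ z_B χ_B(∂)` (`exists_rightMul`).
Associativity transfers this form to left multiplication (`IsLieStar.left_lin`). Hence `p ↦ p ⋆ z_A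
- z_A ⋆ p` is `∑ z_B K_B(∂)`. It kills `1`, so no `K_B` has a constant term, and it maps `z_B` to
`-λ ∑ f_{AB}^C z_C`. Moving one derivative to the left of each `z_B` leaves a remainder whose
constant term is the trace `-c_A = 0`; the rest is a divergence (`mem_totalDiv_of_trace`). General
`q` follows from `[p, q ⋆ z] = [p ⋆ q, z] + [z ⋆ p, q]`, by induction on the order in `λ` and on
`q`.

Polynomials are not integrable, so the passage to functions is made through formal adjoints.
Integration by parts gives `∫ f ⋆ g - ∫ g ⋆ f = ∫ f · L g` at each order, with `L` a differential
operator. On a polynomial `q`, `L q` is the adjoint of the commutator with `q` applied to `1`, and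
it vanishes because that commutator is a divergence. An operator that kills all polynomials kills
all smooth functions, by Taylor expansion (`symbFun_eq_zero`).

Two facts make the definitions meaningful. `Ω` is triangular for the degree in `z`, hence injective
with all polynomials in its range (`Omega_injective`, `exists_Omega_eq`). Each order of `⋆` is a
bidifferential operator of finite order (`uniform_order`), so the sum over Taylor coefficients is
finite. -/

namespace LieStar

noncomputable section

set_option linter.unusedSectionVars false

open MvPolynomial

/-! ### Sums over words -/

section Words

variable {ι : Type*}

/-- The sum of `h` over all words obtained from a given word by deleting one letter `A`. -/
def wordRemove [DecidableEq ι] {X : Type*} [AddCommMonoid X] (A : ι) :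
    (List ι → X) → List ι → X
  | _, [] => 0
  | h, B :: I => (if A = B then h I else 0) + wordRemove A (fun J => h (B :: J)) I

/-- Invariance under permutations of the letters. -/
def WordSymm {Y : Type*} (F : List ι → Y) : Prop :=
  ∀ I J : List ι, I.Perm J → F I = F J

theorem WordSymm.cons {Y : Type*} {F : List ι → Y} (hF : WordSymm F) (A : ι) :
    WordSymm fun I => F (A :: I) :=
  fun _ _ h => hF _ _ (h.cons A)

variable [Fintype ι]

/-- The sum of `F` over all words of length `n`. -/
def wordSum {M : Type*} [AddCommMonoid M] (n : ℕ) (F : List ι → M) : M :=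
  ∑ I : Fin n → ι, F (List.ofFn I)

theorem wordSum_zero {M : Type*} [AddCommMonoid M] (F : List ι → M) :
    wordSum 0 F = F [] := by
  simp [wordSum]

theorem wordSum_succ {M : Type*} [AddCommMonoid M] (n : ℕ) (F : List ι → M) :
    wordSum (n + 1) F = ∑ A, wordSum n fun I => F (A :: I) := by
  unfold wordSum
  rw [← (Fin.consEquiv fun _ : Fin (n + 1) => ι).sum_comp, Fintype.sum_prod_type]
  simp [Fin.consEquiv]

theorem wordSum_add {M : Type*} [AddCommMonoid M] (n : ℕ) (F G : List ι → M) :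
    wordSum n (fun I => F I + G I) = wordSum n F + wordSum n G :=
  Finset.sum_add_distrib

theorem wordSum_congr {M : Type*} [AddCommMonoid M] {n : ℕ} {F G : List ι → M}
    (h : ∀ I : List ι, I.length = n → F I = G I) : wordSum n F = wordSum n G :=
  Finset.sum_congr rfl fun _ _ => h _ (List.length_ofFn)

theorem wordSum_eq_zero {M : Type*} [AddCommMonoid M] {n : ℕ} {F : List ι → M}
    (h : ∀ I : List ι, I.length = n → F I = 0) : wordSum n F = 0 :=
  Finset.sum_eq_zero fun _ _ => h _ (List.length_ofFn)

theorem map_wordSum {M N G : Type*} [AddCommMonoid M] [AddCommMonoid N] [FunLike G M N]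
    [AddMonoidHomClass G M N] (φ : G) (n : ℕ) (F : List ι → M) :
    φ (wordSum n F) = wordSum n fun I => φ (F I) :=
  map_sum φ _ _

/-- There are `n + 1` positions from which `A` can have been deleted, and symmetry of `F` makes them
all contribute equally. The factor `n + 1` converts `1/(n+1)!` into `1/n!`. The pairing `β` is
arbitrary because composition, evaluation and scalar action all occur below. -/
theorem wordSum_wordRemove [DecidableEq ι] {X Y W : Type*} [AddCommMonoid X] [AddCommMonoid Y]
    [AddCommMonoid W] (β : X →+ Y →+ W) (A : ι) (n : ℕ) (h : List ι → X) (F : List ι → Y)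
    (hF : WordSymm F) :
    wordSum (n + 1) (fun I => β (wordRemove A h I) (F I)) =
      (n + 1) • wordSum n (fun I => β (h I) (F (A :: I))) := by
  induction n generalizing h F with
  | zero =>
    simp only [wordSum_succ, wordSum_zero, wordRemove, add_zero, zero_add, one_smul]
    rw [Finset.sum_eq_single A]
    · simp
    · intro B _ hB; simp [hB.symm]
    · simp
  | succ n ih =>
    rw [wordSum_succ]
    simp only [wordRemove, map_add, AddMonoidHom.add_apply, wordSum_add]
    rw [Finset.sum_add_distrib, Finset.sum_congr rfl fun B _ =>
      ih (fun J => h (B :: J)) (fun J => F (B :: J)) (hF.cons B), ← Finset.smul_sum,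
      Finset.sum_eq_single A, succ_nsmul' _ (n + 1)]
    · simp only [if_true]
      congr 2
      rw [wordSum_succ]
      refine Finset.sum_congr rfl fun B _ => ?_
      refine wordSum_congr fun I _ => ?_
      -- The deleted `A` stood behind the first letter `B`; symmetry brings it to the front.
      rw [hF _ _ (List.Perm.swap A B I)]
    · intro B _ hB
      exact wordSum_eq_zero fun I _ => by simp [hB.symm]
    · simp

end Words

/-! ### Differential operators on polynomials -/

section DiffOp

variable {ι : Type*}

/-- Multiplication by the variable `z_A`. -/
def mulX (A : ι) : Module.End ℝ (MvPolynomial ι ℝ) := LinearMap.mulLeft ℝ (X A)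

/-- The partial derivative as a linear operator. -/
def der (A : ι) : Module.End ℝ (MvPolynomial ι ℝ) :=
  ((pderiv A : Derivation ℝ (MvPolynomial ι ℝ) (MvPolynomial ι ℝ)) :
    MvPolynomial ι ℝ →ₗ[ℝ] MvPolynomial ι ℝ)

@[simp] theorem mulX_apply (A : ι) (p : MvPolynomial ι ℝ) : mulX A p = X A * p := rfl

@[simp] theorem der_apply (A : ι) (p : MvPolynomial ι ℝ) : der A p = pderiv A p := rfl

theorem mulX_comm (A B : ι) : mulX A * mulX B = mulX B * mulX A := by
  refine LinearMap.ext fun p => ?_; simp; ring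

theorem pderiv_comm (A B : ι) (p : MvPolynomial ι ℝ) :
    pderiv A (pderiv B p) = pderiv B (pderiv A p) := by
  have := congrArg (PowerSeries.coeff 0) (coeffDeriv_comm A B (PowerSeries.C p))
  simpa [coeffDeriv] using this

theorem der_comm (A B : ι) : der A * der B = der B * der A := by
  refine LinearMap.ext fun p => ?_; simp [pderiv_comm A B]

/-- The commutator `[T, z_A]`. -/
def adX (A : ι) : Module.End ℝ (MvPolynomial ι ℝ) →ₗ[ℝ] Module.End ℝ (MvPolynomial ι ℝ) :=
  LinearMap.mulRight ℝ (mulX A) - LinearMap.mulLeft ℝ (mulX A)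

theorem adX_apply (A : ι) (T : Module.End ℝ (MvPolynomial ι ℝ)) :
    adX A T = T * mulX A - mulX A * T := rfl

theorem adX_apply_apply (A : ι) (T : Module.End ℝ (MvPolynomial ι ℝ)) (p : MvPolynomial ι ℝ) :
    adX A T p = T (X A * p) - X A * T p := rfl

theorem adX_mul (A : ι) (S T : Module.End ℝ (MvPolynomial ι ℝ)) :
    adX A (S * T) = S * adX A T + adX A S * T := by
  simp only [adX_apply, mul_sub, sub_mul, mul_assoc]; abel

theorem adX_comm (A B : ι) (T : Module.End ℝ (MvPolynomial ι ℝ)) :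
    adX A (adX B T) = adX B (adX A T) := by
  refine LinearMap.ext fun p => ?_
  simp only [adX_apply_apply, mul_left_comm (X A) (X B)]
  ring

theorem adX_one (A : ι) : adX A 1 = 0 := by simp [adX_apply]

theorem adX_mulX (A B : ι) : adX A (mulX B) = 0 := by
  rw [adX_apply, mulX_comm, sub_self]

theorem adX_der [DecidableEq ι] (A B : ι) : adX A (der B) = if A = B then 1 else 0 := by
  refine LinearMap.ext fun p => ?_
  rw [adX_apply_apply, der_apply, Derivation.leibniz, pderiv_X]
  split_ifs with h
  · subst h; simp
  · simp [h]

/-- The coefficient of `∂_I / |I|!` in a linear operator on polynomials. -/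
def symb : List ι → Module.End ℝ (MvPolynomial ι ℝ) →ₗ[ℝ] MvPolynomial ι ℝ
  | [] => LinearMap.applyₗ 1
  | A :: I => symb I ∘ₗ adX A

@[simp] theorem symb_nil (T : Module.End ℝ (MvPolynomial ι ℝ)) : symb [] T = T 1 := rfl

@[simp] theorem symb_cons (A : ι) (I : List ι) (T : Module.End ℝ (MvPolynomial ι ℝ)) :
    symb (A :: I) T = symb I (adX A T) := rfl

theorem symb_wordSymm (T : Module.End ℝ (MvPolynomial ι ℝ)) :
    WordSymm fun I : List ι => symb I T := by
  intro I J h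
  induction h generalizing T with
  | nil => rfl
  | cons A _ ih => exact ih _
  | swap A B I => simp only [symb_cons, adX_comm]
  | trans _ _ h1 h2 => exact (h1 T).trans (h2 T)

theorem shiftedMonomial_nil (z : ι → ℝ) : shiftedMonomial z [] = 1 := rfl

theorem shiftedMonomial_cons (z : ι → ℝ) (A : ι) (I : List ι) :
    shiftedMonomial z (A :: I) = (X A - C (z A)) * shiftedMonomial z I := by
  simp [shiftedMonomial]

/-- Since `X A - z_A` vanishes at `z`, moving it out through `T` leaves only the commutator. This
links the Taylor monomials in `bidiff` with symbols. -/
theorem eval_shiftedMonomial (z : ι → ℝ) (I : List ι) (T : Module.End ℝ (MvPolynomial ι ℝ)) :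
    eval z (T (shiftedMonomial z I)) = eval z (symb I T) := by
  induction I generalizing T with
  | nil => rfl
  | cons A I ih =>
    rw [symb_cons, ← ih, adX_apply_apply, shiftedMonomial_cons, sub_mul, ← smul_eq_C_mul]
    simp

theorem symb_mul_left (p : MvPolynomial ι ℝ) (I : List ι)
    (T : Module.End ℝ (MvPolynomial ι ℝ)) :
    symb I (LinearMap.mulLeft ℝ p * T) = p * symb I T := by
  induction I generalizing T with
  | nil => rfl
  | cons A I ih =>
    rw [symb_cons, symb_cons, ← ih]
    congr 1
    refine LinearMap.ext fun q => ?_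
    simp only [adX_apply_apply, Module.End.mul_apply, LinearMap.mulLeft_apply]
    ring

/-- The Leibniz rule for symbols: `∂_A` either differentiates a coefficient or joins the word. -/
theorem symb_der_mul [DecidableEq ι] (A : ι) (I : List ι)
    (T : Module.End ℝ (MvPolynomial ι ℝ)) :
    symb I (der A * T) = pderiv A (symb I T) + wordRemove A (fun J => symb J T) I := by
  induction I generalizing T with
  | nil => simp [wordRemove]
  | cons B I ih =>
    simp only [symb_cons, wordRemove]
    rw [adX_mul, map_add, ih, adX_der]
    simp only [eq_comm (a := B) (b := A)]
    split_ifs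
    · simp only [one_mul, ← symb_cons]
      abel
    · simp

/-- Grothendieck's differential operators of order less than `n`. -/
def diffOp : ℕ → Submodule ℝ (Module.End ℝ (MvPolynomial ι ℝ))
  | 0 => ⊥
  | n + 1 => ⨅ A, (diffOp n).comap (adX A)

theorem mem_diffOp_zero {T : Module.End ℝ (MvPolynomial ι ℝ)} : T ∈ diffOp 0 ↔ T = 0 :=
  Submodule.mem_bot ℝ

theorem mem_diffOp_succ {n : ℕ} {T : Module.End ℝ (MvPolynomial ι ℝ)} :
    T ∈ diffOp (n + 1) ↔ ∀ A, adX A T ∈ diffOp n := by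
  simp [diffOp]

theorem diffOp_le_succ (n : ℕ) : diffOp (ι := ι) n ≤ diffOp (n + 1) := by
  induction n with
  | zero => intro T h; rw [mem_diffOp_zero.1 h]; exact zero_mem _
  | succ n ih =>
    intro T h
    rw [mem_diffOp_succ] at h ⊢
    exact fun A => ih (h A)

theorem diffOp_mono : Monotone (diffOp (ι := ι)) := monotone_nat_of_le_succ diffOp_le_succ

/-- A commutator with a variable falls on one factor and lowers its bound. The bound `m + n` is not
sharp; only finiteness matters. -/
theorem mul_mem_diffOp {m n : ℕ} {S T : Module.End ℝ (MvPolynomial ι ℝ)} (hS : S ∈ diffOp m)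
    (hT : T ∈ diffOp n) : S * T ∈ diffOp (m + n) := by
  obtain ⟨k, hk⟩ : ∃ k, m + n = k := ⟨_, rfl⟩
  rw [hk]
  induction k generalizing m n S T with
  | zero =>
    obtain rfl : m = 0 := by omega
    rw [mem_diffOp_zero.1 hS, zero_mul]; exact zero_mem _
  | succ k ih =>
    rcases m with _ | m
    · rw [mem_diffOp_zero.1 hS, zero_mul]; exact zero_mem _
    rcases n with _ | n
    · rw [mem_diffOp_zero.1 hT, mul_zero]; exact zero_mem _
    rw [mem_diffOp_succ]
    intro A
    rw [adX_mul]
    exact add_mem (ih hS (mem_diffOp_succ.1 hT A) (by omega))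
      (ih (mem_diffOp_succ.1 hS A) hT (by omega))

theorem mulX_mem_diffOp (A : ι) : mulX A ∈ diffOp (ι := ι) 1 := by
  rw [mem_diffOp_succ]; intro B; rw [adX_mulX]; exact zero_mem _

theorem one_mem_diffOp : (1 : Module.End ℝ (MvPolynomial ι ℝ)) ∈ diffOp (ι := ι) 1 := by
  rw [mem_diffOp_succ]; intro B; rw [adX_one]; exact zero_mem _

theorem der_mem_diffOp (A : ι) : der A ∈ diffOp (ι := ι) 2 := by
  classical
  rw [mem_diffOp_succ]; intro B; rw [adX_der]
  split_ifs
  exacts [one_mem_diffOp, zero_mem _]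

theorem mulLeft_mul_mem_diffOp {n : ℕ} (p : MvPolynomial ι ℝ)
    {T : Module.End ℝ (MvPolynomial ι ℝ)} (hT : T ∈ diffOp n) :
    LinearMap.mulLeft ℝ p * T ∈ diffOp n := by
  induction n generalizing T with
  | zero => rw [mem_diffOp_zero.1 hT, mul_zero]; exact zero_mem _
  | succ n ih =>
    rw [mem_diffOp_succ] at hT ⊢
    intro A
    have : adX A (LinearMap.mulLeft ℝ p * T) = LinearMap.mulLeft ℝ p * adX A T := by
      refine LinearMap.ext fun q => ?_
      simp only [adX_apply_apply, Module.End.mul_apply, LinearMap.mulLeft_apply]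
      ring
    rw [this]
    exact ih (hT A)

theorem symb_eq_zero {n : ℕ} {T : Module.End ℝ (MvPolynomial ι ℝ)} (hT : T ∈ diffOp n)
    {I : List ι} (hI : n ≤ I.length) : symb I T = 0 := by
  induction I generalizing n T with
  | nil =>
    obtain rfl : n = 0 := by simpa using hI
    rw [mem_diffOp_zero.1 hT, map_zero]
  | cons A I ih =>
    rcases n with _ | n
    · rw [mem_diffOp_zero.1 hT, map_zero]
    · exact ih (mem_diffOp_succ.1 hT A) (by simpa using hI)

/-- An operator is determined by its value at `1` and its commutators with the variables. -/
theorem ext_adX {S T : Module.End ℝ (MvPolynomial ι ℝ)} (h1 : S 1 = T 1)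
    (h : ∀ A, adX A S = adX A T) : S = T := by
  refine LinearMap.ext fun p => ?_
  induction p using MvPolynomial.induction_on with
  | C a => rw [← mul_one (C a), ← smul_eq_C_mul, map_smul, map_smul, h1]
  | add p q hp hq => rw [map_add, map_add, hp, hq]
  | mul_X p A hp =>
    have := LinearMap.congr_fun (h A) p
    rw [adX_apply_apply, adX_apply_apply, hp, sub_left_inj] at this
    rwa [mul_comm]

/-- The iterated partial derivative of polynomials. -/
def derWord (I : List ι) : Module.End ℝ (MvPolynomial ι ℝ) := (I.map der).prod

@[simp] theorem derWord_nil : derWord (ι := ι) [] = 1 := rfl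

theorem derWord_cons (A : ι) (I : List ι) : derWord (A :: I) = der A * derWord I := by
  simp [derWord]

theorem derWord_comm (A : ι) (I : List ι) : derWord I * der A = der A * derWord I := by
  induction I with
  | nil => simp
  | cons B I ih => rw [derWord_cons, mul_assoc, ih, ← mul_assoc, der_comm, mul_assoc]

theorem derWord_wordSymm : WordSymm (derWord (ι := ι)) := by
  intro I J h
  exact (h.map der).prod_eq' (by
    rw [List.pairwise_map]
    exact List.pairwise_of_forall fun A B => der_comm A B)

theorem adX_derWord [DecidableEq ι] (A : ι) (I : List ι) :
    adX A (derWord I) = wordRemove A derWord I := by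
  -- The left factor `S` absorbs the letters already passed in the induction.
  suffices h : ∀ S : Module.End ℝ (MvPolynomial ι ℝ), S * adX A (derWord I) =
      wordRemove A (fun J => S * derWord J) I by simpa using h 1
  induction I with
  | nil => intro S; simp [wordRemove, adX_one]
  | cons B I ih =>
    intro S
    rw [derWord_cons, adX_mul, adX_der, wordRemove]
    simp only [derWord_cons]
    simp only [← mul_assoc, mul_add]
    rw [ih, add_comm]
    split_ifs <;> simp

variable [Fintype ι]

/-- A differential operator is the sum of its symbol. -/
theorem eq_sum_symb {N : ℕ} {T : Module.End ℝ (MvPolynomial ι ℝ)} (hT : T ∈ diffOp N) :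
    T = ∑ n ∈ Finset.range N, ((n.factorial : ℝ)⁻¹) •
      wordSum n fun I => LinearMap.mulLeft ℝ (symb I T) * derWord I := by
  classical
  induction N generalizing T with
  | zero => rw [mem_diffOp_zero.1 hT]; simp
  | succ N ih =>
    -- The commutator `adX A T` has lower order and its symbols are `symb (A :: I) T`. The induction
    -- hypothesis therefore matches the commutator of the sum, with `n` shifted by one.
    refine ext_adX ?_ fun A => ?_
    · rw [Finset.sum_range_succ', LinearMap.add_apply, LinearMap.sum_apply]
      rw [Finset.sum_eq_zero]
      · simp [wordSum_zero]
      · intro n _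
        rw [LinearMap.smul_apply, wordSum, LinearMap.sum_apply, Finset.sum_eq_zero, smul_zero]
        intro I _
        rw [List.ofFn_succ, derWord_cons, ← derWord_comm]
        simp
    · rw [ih (mem_diffOp_succ.1 hT A), map_sum, Finset.sum_range_succ']
      simp only [map_smul, map_wordSum]
      have h0 : ∀ (p : MvPolynomial ι ℝ) (S : Module.End ℝ (MvPolynomial ι ℝ)),
          adX A (LinearMap.mulLeft ℝ p * S) = LinearMap.mulLeft ℝ p * adX A S := by
        intro p S
        refine LinearMap.ext fun q => ?_
        simp only [adX_apply_apply, Module.End.mul_apply, LinearMap.mulLeft_apply]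
        ring
      simp only [h0, adX_derWord]
      rw [wordSum_zero]
      simp only [wordRemove, mul_zero, smul_zero, add_zero]
      refine Finset.sum_congr rfl fun n _ => ?_
      have := wordSum_wordRemove (AddMonoidHom.mk' (fun S : Module.End ℝ (MvPolynomial ι ℝ) =>
        AddMonoidHom.mk' (fun p : MvPolynomial ι ℝ => LinearMap.mulLeft ℝ p * S)
          (fun p q => LinearMap.ext fun r => by simp [add_mul])) (fun S S' => AddMonoidHom.ext fun p => by simp [mul_add])) A n
          derWord (fun I => symb I T) (symb_wordSymm T)
      simp only [AddMonoidHom.mk'_apply] at this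
      rw [this, ← Nat.cast_smul_eq_nsmul ℝ, smul_smul, Nat.factorial_succ]
      congr 1
      push_cast
      field_simp

theorem apply_eq_sum_symb {N : ℕ} {T : Module.End ℝ (MvPolynomial ι ℝ)} (hT : T ∈ diffOp N)
    (p : MvPolynomial ι ℝ) :
    T p = ∑ n ∈ Finset.range N, ((n.factorial : ℝ)⁻¹) •
      wordSum n fun I => symb I T * derWord I p := by
  conv_lhs => rw [eq_sum_symb hT]
  simp only [LinearMap.sum_apply, LinearMap.smul_apply]
  refine Finset.sum_congr rfl fun n _ => congrArg _ ?_
  exact map_wordSum (LinearMap.applyₗ p : Module.End ℝ (MvPolynomial ι ℝ) →ₗ[ℝ] _) n _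

/-- The formal adjoint of a differential operator, applied to `1`. -/
def adjOne (N : ℕ) (T : Module.End ℝ (MvPolynomial ι ℝ)) : MvPolynomial ι ℝ :=
  ∑ n ∈ Finset.range N, ((-1) ^ n * (n.factorial : ℝ)⁻¹) •
    wordSum n fun I => derWord I (symb I T)

theorem adjOne_eq {N N' : ℕ} {T : Module.End ℝ (MvPolynomial ι ℝ)} (hT : T ∈ diffOp N)
    (h : N ≤ N') : adjOne N' T = adjOne N T := by
  unfold adjOne
  symm
  refine Finset.sum_subset (Finset.range_mono h) fun n _ hn => ?_
  rw [wordSum_eq_zero, smul_zero]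
  intro I hI
  rw [symb_eq_zero hT (by simpa [hI] using hn), map_zero]

/-- Formally, `(∂_A T)^* 1 = -T^* (∂_A 1) = 0`. In terms of symbols, the two terms of `symb_der_mul`
cancel after a shift of `n` by one. -/
theorem adjOne_der_mul {N : ℕ} (A : ι) {T : Module.End ℝ (MvPolynomial ι ℝ)}
    (hT : T ∈ diffOp N) : adjOne (N + 1) (der A * T) = 0 := by
  classical
  unfold adjOne
  simp only [symb_der_mul, map_add, wordSum_add, smul_add]
  -- The first sum loses its top term, which vanishes by the order bound, and the second its term `n
  -- = 0`, where no letter can be removed.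
  rw [Finset.sum_add_distrib, Finset.sum_range_succ, Finset.sum_range_succ' (n := N),
    wordSum_zero, wordSum_eq_zero (n := N)]
  · simp only [wordRemove, map_zero, smul_zero, add_zero]
    rw [← Finset.sum_add_distrib]
    refine Finset.sum_eq_zero fun n _ => ?_
    have := wordSum_wordRemove (AddMonoidHom.mk' (fun p : MvPolynomial ι ℝ =>
        AddMonoidHom.mk' (fun S : Module.End ℝ (MvPolynomial ι ℝ) => S p)
          (fun S S' => by simp)) (fun p q => AddMonoidHom.ext fun S => by simp)) A n
          (fun I => symb I T) derWord derWord_wordSymm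
    simp only [AddMonoidHom.mk'_apply] at this
    rw [this, ← Nat.cast_smul_eq_nsmul ℝ, smul_smul, Nat.factorial_succ]
    have h2 : ∀ I : List ι, derWord (A :: I) (symb I T) = derWord I (pderiv A (symb I T)) := by
      intro I
      rw [derWord_cons, ← derWord_comm]; rfl
    simp only [h2, ← add_smul]
    convert zero_smul ℝ _
    push_cast
    field_simp
    ring
  · intro I hI
    rw [symb_eq_zero hT hI.ge]
    simp

end DiffOp

/-! ### Operators linear in `z`, and total divergences -/

section Operators

variable {ι : Type*}

/-- Differential operators of arbitrary finite order. -/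
def diffOps (ι : Type*) : Subalgebra ℝ (Module.End ℝ (MvPolynomial ι ℝ)) where
  carrier := {T | ∃ N, T ∈ diffOp N}
  mul_mem' := by
    rintro S T ⟨m, hm⟩ ⟨n, hn⟩
    exact ⟨_, mul_mem_diffOp hm hn⟩
  add_mem' := by
    rintro S T ⟨m, hm⟩ ⟨n, hn⟩
    exact ⟨max m n, add_mem (diffOp_mono (le_max_left m n) hm)
      (diffOp_mono (le_max_right m n) hn)⟩
  algebraMap_mem' r := by
    rw [Algebra.algebraMap_eq_smul_one]
    exact ⟨1, Submodule.smul_mem _ _ one_mem_diffOp⟩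

theorem mulX_mem_diffOps (A : ι) : mulX A ∈ diffOps ι := ⟨1, mulX_mem_diffOp A⟩

theorem der_mem_diffOps (A : ι) : der A ∈ diffOps ι := ⟨2, der_mem_diffOp A⟩

/-- Moving a derivative to the far left costs a Kronecker delta. This is the source of the trace. -/
theorem adX_der_mul_sub [DecidableEq ι] (A B : ι) (T : Module.End ℝ (MvPolynomial ι ℝ)) :
    mulX A * (der B * T) = der B * (mulX A * T) - if A = B then T else 0 := by
  have h := adX_der A B
  rw [adX_apply, sub_eq_iff_eq_add] at h
  rw [← mul_assoc, ← mul_assoc, h, add_mul]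
  split_ifs <;> simp

/-- The differential operators with constant coefficients. -/
def constOp (ι : Type*) : Subalgebra ℝ (Module.End ℝ (MvPolynomial ι ℝ)) :=
  Algebra.adjoin ℝ (Set.range der)

theorem der_mem_constOp (A : ι) : der A ∈ constOp ι := Algebra.subset_adjoin ⟨A, rfl⟩

theorem constOp_le_diffOps : constOp ι ≤ diffOps ι :=
  Algebra.adjoin_le (by rintro _ ⟨A, rfl⟩; exact der_mem_diffOps A)

theorem derWord_mem_constOp (I : List ι) : derWord I ∈ constOp ι := by
  induction I with
  | nil => exact one_mem _
  | cons A I ih => rw [derWord_cons]; exact mul_mem (der_mem_constOp A) ih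

theorem constOp_commute {S T : Module.End ℝ (MvPolynomial ι ℝ)} (hS : S ∈ constOp ι)
    (hT : T ∈ constOp ι) : S * T = T * S := by
  have h : ∀ U ∈ constOp ι, ∀ A, U * der A = der A * U := by
    intro U hU A
    induction hU using Algebra.adjoin_induction with
    | mem x hx => obtain ⟨B, rfl⟩ := hx; exact der_comm B A
    | algebraMap r => exact Algebra.commutes r _
    | add x y _ _ hx hy => rw [add_mul, mul_add, hx, hy]
    | mul x y _ _ hx hy => rw [mul_assoc, hy, ← mul_assoc, hx, mul_assoc]
  induction hT using Algebra.adjoin_induction with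
  | mem x hx => obtain ⟨B, rfl⟩ := hx; exact h S hS B
  | algebraMap r => exact (Algebra.commutes r _).symm
  | add x y _ _ hx hy => rw [add_mul, mul_add, hx, hy]
  | mul x y _ _ hx hy => rw [← mul_assoc, hx, mul_assoc, hy, mul_assoc]

theorem adX_mem_constOp (A : ι) {K : Module.End ℝ (MvPolynomial ι ℝ)} (hK : K ∈ constOp ι) :
    adX A K ∈ constOp ι := by
  classical
  induction hK using Algebra.adjoin_induction with
  | mem x hx =>
    obtain ⟨B, rfl⟩ := hx
    rw [adX_der]
    split_ifs
    exacts [one_mem _, zero_mem _]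
  | algebraMap r =>
    rw [Algebra.algebraMap_eq_smul_one, map_smul, adX_one, smul_zero]; exact zero_mem _
  | add x y _ _ hx hy => rw [map_add]; exact add_mem hx hy
  | mul x y hx' hy' hx hy =>
    rw [adX_mul]; exact add_mem (mul_mem hx' hy) (mul_mem hx hy')

theorem constOp_apply_one {K : Module.End ℝ (MvPolynomial ι ℝ)} (hK : K ∈ constOp ι) :
    ∃ c : ℝ, ∀ a : ℝ, K (C a) = C (a * c) := by
  induction hK using Algebra.adjoin_induction with
  | mem x hx => obtain ⟨B, rfl⟩ := hx; exact ⟨0, fun a => by simp⟩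
  | algebraMap r =>
    exact ⟨r, fun a => by simp [Algebra.algebraMap_eq_smul_one, smul_eq_C_mul, mul_comm]⟩
  | add x y _ _ hx hy =>
    obtain ⟨c, hc⟩ := hx
    obtain ⟨d, hd⟩ := hy
    exact ⟨c + d, fun a => by rw [LinearMap.add_apply, hc, hd, mul_add, C_add]⟩
  | mul x y _ _ hx hy =>
    obtain ⟨c, hc⟩ := hx
    obtain ⟨d, hd⟩ := hy
    exact ⟨d * c, fun a => by rw [Module.End.mul_apply, hd, hc, mul_assoc]⟩

theorem symb_constOp {K : Module.End ℝ (MvPolynomial ι ℝ)} (hK : K ∈ constOp ι) (I : List ι) :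
    ∃ c : ℝ, symb I K = C c := by
  induction I generalizing K with
  | nil =>
    obtain ⟨c, hc⟩ := constOp_apply_one hK
    exact ⟨1 * c, by simpa using hc 1⟩
  | cons A I ih => exact ih (adX_mem_constOp A hK)

/-- The operators `∑ B, z_B χ_B(∂)`. -/
def linOp (ι : Type*) : Submodule ℝ (Module.End ℝ (MvPolynomial ι ℝ)) :=
  Submodule.span ℝ {T | ∃ B, ∃ K ∈ constOp ι, T = mulX B * K}

theorem mulX_mul_mem_linOp (B : ι) {K : Module.End ℝ (MvPolynomial ι ℝ)} (hK : K ∈ constOp ι) :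
    mulX B * K ∈ linOp ι := Submodule.subset_span ⟨B, K, hK, rfl⟩

theorem linOp_le_diffOps {T : Module.End ℝ (MvPolynomial ι ℝ)} (hT : T ∈ linOp ι) :
    T ∈ diffOps ι := by
  have : linOp ι ≤ Subalgebra.toSubmodule (diffOps ι) := by
    refine Submodule.span_le.2 ?_
    rintro _ ⟨B, K, hK, rfl⟩
    exact (diffOps ι).mul_mem (mulX_mem_diffOps B) (constOp_le_diffOps hK)
  exact this hT

/-- The quadratic parts `z_B z_D K K'` cancel, since variables commute with each other and so do
constant-coefficient operators. What remains contains the commutators `[K, z_D]` and `[K', z_B]`,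
which again have constant coefficients. -/
theorem commutator_mem_linOp {S T : Module.End ℝ (MvPolynomial ι ℝ)} (hS : S ∈ linOp ι)
    (hT : T ∈ linOp ι) : S * T - T * S ∈ linOp ι := by
  induction hS using Submodule.span_induction with
  | mem x hx =>
    induction hT using Submodule.span_induction with
    | mem y hy =>
      obtain ⟨B, K, hK, rfl⟩ := hx
      obtain ⟨D, K', hK', rfl⟩ := hy
      have h1 : mulX B * K * (mulX D * K') - mulX D * K' * (mulX B * K) =
          mulX B * (adX D K * K') - mulX D * (adX B K' * K) := by
        have e : mulX B * (mulX D * (K * K')) = mulX D * (mulX B * (K' * K)) := by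
          rw [constOp_commute hK hK', ← mul_assoc, mulX_comm, mul_assoc]
        simp only [adX_apply, sub_mul, mul_sub, mul_assoc] at e ⊢
        rw [e]
        abel
      rw [h1]
      exact sub_mem (mulX_mul_mem_linOp _ (mul_mem (adX_mem_constOp _ hK) hK'))
        (mulX_mul_mem_linOp _ (mul_mem (adX_mem_constOp _ hK') hK))
    | zero => simp
    | add y y' _ _ hy hy' =>
      rw [mul_add, add_mul, add_sub_add_comm]; exact add_mem hy hy'
    | smul r y _ hy =>
      rw [mul_smul_comm, smul_mul_assoc, ← smul_sub]; exact Submodule.smul_mem _ _ hy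
  | zero => simp
  | add y y' _ _ hy hy' =>
    rw [mul_add, add_mul, add_sub_add_comm]; exact add_mem hy hy'
  | smul r y _ hy =>
    rw [mul_smul_comm, smul_mul_assoc, ← smul_sub]; exact Submodule.smul_mem _ _ hy

theorem symb_linOp {T : Module.End ℝ (MvPolynomial ι ℝ)} (hT : T ∈ linOp ι) (I : List ι) :
    symb I T ∈ Submodule.span ℝ (Set.range (X : ι → MvPolynomial ι ℝ)) := by
  induction hT using Submodule.span_induction with
  | mem x hx =>
    obtain ⟨B, K, hK, rfl⟩ := hx
    obtain ⟨c, hc⟩ := symb_constOp hK I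
    rw [mulX, symb_mul_left, hc, mul_comm, ← smul_eq_C_mul]
    exact Submodule.smul_mem _ _ (Submodule.subset_span ⟨B, rfl⟩)
  | zero => simp
  | add y y' _ _ hy hy' => rw [map_add]; exact add_mem hy hy'
  | smul r y _ hy => rw [map_smul]; exact Submodule.smul_mem _ _ hy

theorem mulLeft_mul_mem_linOp {p : MvPolynomial ι ℝ}
    (hp : p ∈ Submodule.span ℝ (Set.range (X : ι → MvPolynomial ι ℝ)))
    {K : Module.End ℝ (MvPolynomial ι ℝ)} (hK : K ∈ constOp ι) :
    LinearMap.mulLeft ℝ p * K ∈ linOp ι := by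
  induction hp using Submodule.span_induction with
  | mem x hx => obtain ⟨B, rfl⟩ := hx; exact mulX_mul_mem_linOp B hK
  | zero => simp
  | add x y _ _ hx hy =>
    have : LinearMap.mulLeft ℝ (x + y) = LinearMap.mulLeft ℝ x + LinearMap.mulLeft ℝ y :=
      LinearMap.ext fun q => by simp [add_mul]
    rw [this, add_mul]; exact add_mem hx hy
  | smul r x _ hx =>
    have : LinearMap.mulLeft ℝ (r • x) = r • LinearMap.mulLeft ℝ x :=
      LinearMap.ext fun q => by simp
    rw [this, smul_mul_assoc]; exact Submodule.smul_mem _ _ hx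

/-- The operators `∑ A, ∂_A T_A`, whose values are total divergences. -/
def totalDiv (ι : Type*) : Submodule ℝ (Module.End ℝ (MvPolynomial ι ℝ)) :=
  Submodule.span ℝ {T | ∃ A, ∃ S ∈ diffOps ι, T = der A * S}

theorem der_mul_mem_totalDiv (A : ι) {S : Module.End ℝ (MvPolynomial ι ℝ)}
    (hS : S ∈ diffOps ι) : der A * S ∈ totalDiv ι := Submodule.subset_span ⟨A, S, hS, rfl⟩

theorem totalDiv_mul_mem {T S : Module.End ℝ (MvPolynomial ι ℝ)} (hT : T ∈ totalDiv ι)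
    (hS : S ∈ diffOps ι) : T * S ∈ totalDiv ι := by
  induction hT using Submodule.span_induction with
  | mem x hx =>
    obtain ⟨A, U, hU, rfl⟩ := hx
    rw [mul_assoc]
    exact der_mul_mem_totalDiv A (mul_mem hU hS)
  | zero => simp
  | add y y' _ _ hy hy' => rw [add_mul]; exact add_mem hy hy'
  | smul r y _ hy => rw [smul_mul_assoc]; exact Submodule.smul_mem _ _ hy

open Finset.HasAntidiagonal in
-- The two terms containing `ν k` are paired with `R 0 = z_A` and form the commutator; all others
-- contain `ν i` with `i < k`. Properties of `ν` can thus be proved by recursion on the order in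
-- `λ`.
theorem adX_of_intertwine (A : ι) {R ν : ℕ → Module.End ℝ (MvPolynomial ι ℝ)}
    (hR : R 0 = mulX A) (k : ℕ)
    (h : ∑ x ∈ antidiagonal k, R x.1 * ν x.2 = ∑ x ∈ antidiagonal k, ν x.1 * R x.2) :
    adX A (ν k) = ∑ i ∈ Finset.range k, (R (k - i) * ν i - ν i * R (k - i)) := by
  rw [← Finset.Nat.sum_antidiagonal_swap] at h
  simp only [Prod.fst_swap, Prod.snd_swap] at h
  rw [Finset.Nat.sum_antidiagonal_eq_sum_range_succ (fun i j => R j * ν i),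
    Finset.Nat.sum_antidiagonal_eq_sum_range_succ (fun i j => ν i * R j),
    Finset.sum_range_succ, Finset.sum_range_succ, Nat.sub_self, hR] at h
  rw [adX_apply, Finset.sum_sub_distrib, sub_eq_sub_iff_add_eq_add, add_comm, ← h, add_comm]

variable [Fintype ι]

/-- The bound `N₀` depends on the orders of the operators in a chosen divergence representation,
which may exceed the order of `T`. -/
theorem adjOne_totalDiv {T : Module.End ℝ (MvPolynomial ι ℝ)} (hT : T ∈ totalDiv ι) :
    ∃ N₀, ∀ N, N₀ ≤ N → adjOne N T = 0 := by
  have hadd : ∀ N (S T : Module.End ℝ (MvPolynomial ι ℝ)),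
      adjOne N (S + T) = adjOne N S + adjOne N T := by
    intro N S T
    simp only [adjOne, map_add, wordSum_add, smul_add, Finset.sum_add_distrib]
  have hsmul : ∀ N (r : ℝ) (T : Module.End ℝ (MvPolynomial ι ℝ)),
      adjOne N (r • T) = r • adjOne N T := by
    intro N r T
    simp only [adjOne, map_smul, wordSum, ← Finset.smul_sum, smul_comm _ r]
  induction hT using Submodule.span_induction with
  | mem x hx =>
    obtain ⟨A, U, ⟨n, hU⟩, rfl⟩ := hx
    refine ⟨n + 1, fun N hN => ?_⟩
    obtain ⟨N, rfl⟩ : ∃ M, N = M + 1 := ⟨N - 1, by omega⟩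
    exact adjOne_der_mul A (diffOp_mono (by omega) hU)
  | zero => exact ⟨0, fun N _ => by simpa using hsmul N 0 0⟩
  | add x y _ _ hx hy =>
    obtain ⟨m, hm⟩ := hx
    obtain ⟨n, hn⟩ := hy
    refine ⟨max m n, fun N hN => ?_⟩
    rw [hadd, hm N (le_of_max_le_left hN), hn N (le_of_max_le_right hN), add_zero]
  | smul r x _ hx =>
    obtain ⟨m, hm⟩ := hx
    exact ⟨m, fun N hN => by rw [hsmul, hm N hN, smul_zero]⟩

theorem constOp_expand {K : Module.End ℝ (MvPolynomial ι ℝ)} (hK : K ∈ constOp ι) :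
    ∃ (c : ℝ) (K' : ι → Module.End ℝ (MvPolynomial ι ℝ)), (∀ A, K' A ∈ constOp ι) ∧
      K = c • 1 + ∑ A, der A * K' A := by
  classical
  induction hK using Algebra.adjoin_induction with
  | mem x hx =>
    obtain ⟨B, rfl⟩ := hx
    refine ⟨0, fun A => if A = B then 1 else 0, fun A => ?_, by simp⟩
    dsimp only
    split_ifs
    exacts [one_mem _, zero_mem _]
  | algebraMap r =>
    exact ⟨r, fun _ => 0, fun _ => zero_mem _, by simp [Algebra.algebraMap_eq_smul_one]⟩
  | add x y _ _ hx hy =>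
    obtain ⟨c, K, hK, rfl⟩ := hx
    obtain ⟨d, K', hK', rfl⟩ := hy
    refine ⟨c + d, fun A => K A + K' A, fun A => add_mem (hK A) (hK' A), ?_⟩
    simp only [mul_add, Finset.sum_add_distrib, add_smul]
    abel
  | mul x y _ hy' hx hy =>
    obtain ⟨c, K, hK, rfl⟩ := hx
    obtain ⟨d, K', hK', e⟩ := hy
    refine ⟨c * d, fun A => c • K' A + K A * y, fun A => add_mem
      (Subalgebra.smul_mem _ (hK' A) c) (mul_mem (hK A) hy'), ?_⟩
    simp only [mul_add, Finset.sum_add_distrib, add_mul, ← mul_assoc, Finset.sum_mul]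
    rw [← add_assoc, smul_mul_assoc, one_mul]
    congr 1
    rw [e]
    simp only [smul_add, smul_smul, Finset.smul_sum, mul_smul_comm]

theorem linOp_expand {T : Module.End ℝ (MvPolynomial ι ℝ)} (hT : T ∈ linOp ι) :
    ∃ K : ι → Module.End ℝ (MvPolynomial ι ℝ), (∀ A, K A ∈ constOp ι) ∧
      T = ∑ A, mulX A * K A := by
  classical
  induction hT using Submodule.span_induction with
  | mem x hx =>
    obtain ⟨B, K, hK, rfl⟩ := hx
    refine ⟨fun A => if A = B then K else 0, fun A => ?_, by simp⟩
    dsimp only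
    split_ifs
    exacts [hK, zero_mem _]
  | zero => exact ⟨fun _ => 0, fun _ => zero_mem _, by simp⟩
  | add x y _ _ hx hy =>
    obtain ⟨K, hK, rfl⟩ := hx
    obtain ⟨K', hK', rfl⟩ := hy
    exact ⟨fun A => K A + K' A, fun A => add_mem (hK A) (hK' A), by
      simp only [mul_add, Finset.sum_add_distrib]⟩
  | smul r x _ hx =>
    obtain ⟨K, hK, rfl⟩ := hx
    exact ⟨fun A => r • K A, fun A => Subalgebra.smul_mem _ (hK A) r, by
      simp only [mul_smul_comm, Finset.smul_sum]⟩

theorem exists_uniform {Q : ι → ℕ → Prop} (hQ : ∀ A m n, m ≤ n → Q A m → Q A n)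
    (h : ∀ A, ∃ n, Q A n) : ∃ n, ∀ A, Q A n := by
  choose n hn using h
  exact ⟨Finset.univ.sup n, fun A => hQ A _ _ (Finset.le_sup (Finset.mem_univ A)) (hn A)⟩

theorem mem_diffOps_of_adX {T : Module.End ℝ (MvPolynomial ι ℝ)}
    (h : ∀ A, adX A T ∈ diffOps ι) : T ∈ diffOps ι := by
  obtain ⟨n, hn⟩ := exists_uniform (Q := fun A n => adX A T ∈ diffOp n)
    (fun A _ _ hmn h => diffOp_mono hmn h) h
  exact ⟨n + 1, mem_diffOp_succ.2 hn⟩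

/-- In the symbol expansion of `T`, the coefficient of the empty word is `T 1` and that of `A :: J`
is a symbol of `adX A T`; all are linear forms. -/
theorem mem_linOp_of_adX {T : Module.End ℝ (MvPolynomial ι ℝ)} (h : ∀ A, adX A T ∈ linOp ι)
    (h1 : T 1 ∈ Submodule.span ℝ (Set.range (X : ι → MvPolynomial ι ℝ))) : T ∈ linOp ι := by
  obtain ⟨N, hN⟩ := mem_diffOps_of_adX fun A => linOp_le_diffOps (h A)
  rw [eq_sum_symb hN]
  refine sum_mem fun n _ => Submodule.smul_mem _ _ (sum_mem fun I _ =>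
    mulLeft_mul_mem_linOp ?_ (derWord_mem_constOp _))
  cases List.ofFn I with
  | nil => exact h1
  | cons A J => exact symb_linOp (h A) J

theorem sum_smul_X_inj {a b : ι → ℝ}
    (h : ∑ A, a A • (X A : MvPolynomial ι ℝ) = ∑ A, b A • (X A : MvPolynomial ι ℝ)) (B : ι) :
    a B = b B := by
  classical
  have := congrArg (pderiv B) h
  simpa [pderiv_X, Pi.single_apply, smul_eq_C_mul] using this

/-- A linear operator without zeroth-order and trace terms has divergence values. -/
theorem mem_totalDiv_of_trace {T : Module.End ℝ (MvPolynomial ι ℝ)} (hT : T ∈ linOp ι)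
    (h1 : T 1 = 0) (m : ι → ι → ℝ)
    (hm : ∀ B, T (X B) = ∑ D, m B D • (X D : MvPolynomial ι ℝ)) (htr : ∑ B, m B B = 0) :
    T ∈ totalDiv ι := by
  classical
  obtain ⟨K, hK, rfl⟩ := linOp_expand hT
  -- Expansion to second order: `K_A = c_A + ∑ ∂_B (d_{AB} + ∑ ∂_D K2_{ABD})`.
  choose c K1 hK1 e1 using fun A => constOp_expand (hK A)
  choose d K2 hK2 e2 using fun A B => constOp_expand (hK1 A B)
  have hd : ∀ A (p : MvPolynomial ι ℝ) B, (∀ D, K2 A B D (pderiv D p) = 0) →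
      K1 A B p = d A B • p := by
    intro A p B hp
    rw [e2 A B]
    simp only [LinearMap.add_apply, LinearMap.smul_apply, Module.End.one_apply,
      LinearMap.sum_apply]
    rw [Finset.sum_eq_zero, add_zero]
    intro D _
    rw [← constOp_commute (hK2 A B D) (der_mem_constOp D), Module.End.mul_apply, der_apply, hp]
  -- The value at `1` is `∑ c_A z_A`.
  have hc : ∀ A, c A = 0 := by
    refine fun A => sum_smul_X_inj (b := 0) ?_ A
    rw [← sub_eq_zero, ← h1]
    simp only [LinearMap.sum_apply, Module.End.mul_apply, mulX_apply, Pi.zero_apply, zero_smul,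
      Finset.sum_const_zero, sub_zero]
    refine Finset.sum_congr rfl fun B _ => ?_
    rw [e1 B]
    simp only [LinearMap.add_apply, LinearMap.smul_apply, Module.End.one_apply,
      LinearMap.sum_apply]
    rw [Finset.sum_eq_zero]
    · simp [smul_eq_C_mul, mul_comm]
    · intro D _
      rw [← constOp_commute (hK1 B D) (der_mem_constOp D)]
      simp
  -- The value at `z_B` is `∑ d_{AB} z_A`, the constants `c` having vanished.
  have hm' : ∀ A B, d A B = m B A := by
    intro A B
    refine sum_smul_X_inj (a := fun A => d A B) ?_ A
    rw [← hm]
    simp only [LinearMap.sum_apply, Module.End.mul_apply, mulX_apply]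
    refine Finset.sum_congr rfl fun D _ => ?_
    rw [e1 D]
    simp only [LinearMap.sum_apply, hc, zero_smul, zero_add]
    rw [Finset.sum_eq_single B]
    · rw [← constOp_commute (hK1 D B) (der_mem_constOp B)]
      simp only [Module.End.mul_apply, der_apply, pderiv_X_self]
      rw [hd]
      · simp [smul_eq_C_mul, mul_comm]
      · simp
    · intro E _ hE
      rw [← constOp_commute (hK1 D E) (der_mem_constOp E)]
      simp [pderiv_X, hE.symm]
    · simp
  -- Moving `∂_B` to the left of `z_A` leaves `-∑ K1 A A`, whose constant term `∑ d_{AA}` is the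
  -- trace, hence zero; the remainder of `K1 A A` already begins with a derivative.
  have key : ∑ A, mulX A * K A = ∑ A, ∑ B, der B * (mulX A * K1 A B) -
      ∑ A, ∑ B, der B * K2 A A B := by
    have h2 : ∑ A, K1 A A = ∑ A, ∑ B, der B * K2 A A B := by
      have : ∑ A, K1 A A = ∑ A, (d A A • (1 : Module.End ℝ (MvPolynomial ι ℝ)) +
          ∑ B, der B * K2 A A B) := Finset.sum_congr rfl fun A _ => e2 A A
      rw [this, Finset.sum_add_distrib, ← Finset.sum_smul]
      simp only [hm', htr, zero_smul, zero_add]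
    rw [← h2, ← Finset.sum_sub_distrib]
    refine Finset.sum_congr rfl fun A _ => ?_
    conv_lhs => rw [e1 A]
    rw [hc, zero_smul, zero_add, Finset.mul_sum]
    simp only [adX_der_mul_sub]
    simp
  rw [key]
  refine sub_mem (sum_mem fun A _ => sum_mem fun B _ => der_mul_mem_totalDiv _ ?_)
    (sum_mem fun A _ => sum_mem fun B _ => der_mul_mem_totalDiv _ ?_)
  · exact mul_mem (mulX_mem_diffOps A) (constOp_le_diffOps (hK1 A B))
  · exact constOp_le_diffOps (hK2 A A B)

end Operators

/-! ### Star products on polynomials, order by order -/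

section Star

variable {ι : Type*} [Fintype ι]

open Finset.HasAntidiagonal in
/-- An associative unital star product `p ⋆ q = ∑ λ ^ k μ_k(p, q)` of polynomials, for which right
multiplication by `z_A` is of the form `∑ B, z_B χ_B(∂)` and
`[z_A, z_B] = λ ∑ C, f_{AB}^C z_C`. -/
structure IsLieStar (f : ι → ι → ι → ℝ)
    (μ : ℕ → MvPolynomial ι ℝ →ₗ[ℝ] Module.End ℝ (MvPolynomial ι ℝ)) : Prop where
  assoc : ∀ k p q r, ∑ x ∈ antidiagonal k, μ x.1 (μ x.2 p q) r =
    ∑ x ∈ antidiagonal k, μ x.1 p (μ x.2 q r)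
  one_left : ∀ k p, μ k 1 p = if k = 0 then p else 0
  one_right : ∀ k p, μ k p 1 = if k = 0 then p else 0
  zero_X : ∀ p A, μ 0 p (X A) = X A * p
  right_lin : ∀ k A, (μ k).flip (X A) ∈ linOp ι
  comm : ∀ k A B, μ k (X A) (X B) - μ k (X B) (X A) =
    if k = 1 then ∑ C, f A B C • X C else 0

open Finset.HasAntidiagonal

/-- By `adX_of_intertwine`, the commutators of `ν k p` with variables are built from `R` and from `ν
i p` with `i < k`. The order bound obtained by induction therefore does not depend on `p`. -/
theorem uniform_order {κ : Type*} {R : ι → ℕ → Module.End ℝ (MvPolynomial ι ℝ)}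
    {ν : ℕ → κ → Module.End ℝ (MvPolynomial ι ℝ)} (hR0 : ∀ A, R A 0 = mulX A)
    (hR : ∀ A k, R A k ∈ diffOps ι)
    (h : ∀ A k p, ∑ x ∈ antidiagonal k, R A x.1 * ν x.2 p =
      ∑ x ∈ antidiagonal k, ν x.1 p * R A x.2) (k : ℕ) :
    ∃ N, ∀ p, ν k p ∈ diffOp N := by
  induction k using Nat.strong_induction_on with
  | _ k ih =>
    have h1 : ∀ A, ∃ N, ∀ p, adX A (ν k p) ∈ diffOp N := by
      intro A
      choose r hr using hR
      choose n hn using ih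
      obtain ⟨N, hN⟩ : ∃ N, ∀ i (hi : i < k), n i hi + r A (k - i) ≤ N := by
        refine ⟨∑ i : Fin k, (n i i.2 + r A (k - i)), fun i hi => ?_⟩
        exact Finset.single_le_sum (f := fun i : Fin k => n i i.2 + r A (k - i))
          (fun _ _ => Nat.zero_le _) (Finset.mem_univ ⟨i, hi⟩)
      refine ⟨N, fun p => ?_⟩
      rw [adX_of_intertwine A (ν := fun i => ν i p) (hR0 A) k (h A k p)]
      refine sum_mem fun i hi => ?_
      have hi := Finset.mem_range.1 hi
      exact sub_mem (diffOp_mono (by have := hN i hi; omega) (mul_mem_diffOp (hr A _) (hn i hi p)))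
        (diffOp_mono (hN i hi) (mul_mem_diffOp (hn i hi p) (hr A _)))
    obtain ⟨N, hN⟩ := exists_uniform (fun A _ _ hmn h p => diffOp_mono hmn (h p)) h1
    exact ⟨N + 1, fun p => mem_diffOp_succ.2 fun A => hN A p⟩

namespace IsLieStar

variable {f : ι → ι → ι → ℝ} {μ : ℕ → MvPolynomial ι ℝ →ₗ[ℝ] Module.End ℝ (MvPolynomial ι ℝ)}

theorem right_zero (h : IsLieStar f μ) (A : ι) : (μ 0).flip (X A) = mulX A :=
  LinearMap.ext fun p => h.zero_X p A

/-- Associativity `(p ⋆ q) ⋆ z_A = p ⋆ (q ⋆ z_A)`, read as an identity of operators in `q`. -/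
theorem right_intertwine (h : IsLieStar f μ) (A : ι) (k : ℕ) (p : MvPolynomial ι ℝ) :
    ∑ x ∈ antidiagonal k, (μ x.1).flip (X A) * μ x.2 p =
      ∑ x ∈ antidiagonal k, μ x.1 p * (μ x.2).flip (X A) := by
  refine LinearMap.ext fun q => ?_
  simpa [LinearMap.sum_apply] using h.assoc k p q (X A)

theorem left_intertwine (h : IsLieStar f μ) (A : ι) (k : ℕ) (q : MvPolynomial ι ℝ) :
    ∑ x ∈ antidiagonal k, μ x.1 (X A) * (μ x.2).flip q =
      ∑ x ∈ antidiagonal k, (μ x.1).flip q * μ x.2 (X A) := by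
  refine LinearMap.ext fun p => ?_
  simpa [LinearMap.sum_apply] using (h.assoc k (X A) p q).symm

/-- Normal ordering exhibits only right multiplication as linear in `z`. Left multiplication
inherits this through associativity: its commutators with variables are commutators of linear
operators, and its value at `1` is linear. -/
theorem left_lin (h : IsLieStar f μ) (k : ℕ) (A : ι) : μ k (X A) ∈ linOp ι := by
  induction k using Nat.strong_induction_on with
  | _ k ih =>
    refine mem_linOp_of_adX (fun B => ?_) ?_
    · rw [adX_of_intertwine B (ν := fun i => μ i (X A)) (R := fun i => (μ i).flip (X B))
        (h.right_zero B) k (h.right_intertwine B k (X A))]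
      exact sum_mem fun i hi => commutator_mem_linOp (h.right_lin _ _)
        (ih i (Finset.mem_range.1 hi))
    · rw [h.one_right]
      split_ifs
      exacts [Submodule.subset_span ⟨A, rfl⟩, zero_mem _]

theorem left_zero (h : IsLieStar f μ) (A : ι) : μ 0 (X A) = mulX A := by
  refine ext_adX (by simp [h.one_right]) fun B => ?_
  rw [adX_of_intertwine B (ν := fun i => μ i (X A)) (R := fun i => (μ i).flip (X B))
    (h.right_zero B) 0 (h.right_intertwine B 0 (X A)), adX_mulX]
  rfl

theorem order_left (h : IsLieStar f μ) (k : ℕ) : ∃ N, ∀ p, μ k p ∈ diffOp N :=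
  uniform_order (R := fun A k => (μ k).flip (X A)) (ν := fun k p => μ k p) h.right_zero
    (fun A k => linOp_le_diffOps (h.right_lin k A)) h.right_intertwine k

theorem order_right (h : IsLieStar f μ) (k : ℕ) : ∃ N, ∀ q, (μ k).flip q ∈ diffOp N :=
  uniform_order (R := fun A k => μ k (X A)) (ν := fun k q => (μ k).flip q) h.left_zero
    (fun A k => linOp_le_diffOps (h.left_lin k A)) h.left_intertwine k

/-- The commutator kills `1` and acts on the variables as `-f_{AB}^D` at order one and as zero at
other orders, so its trace is `-c_A = 0`. -/
theorem generator_totalDiv (h : IsLieStar f μ) (hf : ∀ A, ∑ B, f A B B = 0) (k : ℕ) (A : ι) :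
    (μ k).flip (X A) - μ k (X A) ∈ totalDiv ι := by
  refine mem_totalDiv_of_trace (sub_mem (h.right_lin k A) (h.left_lin k A)) ?_
    (fun B D => if k = 1 then - f A B D else 0) (fun B => ?_) ?_
  · simp [h.one_left, h.one_right]
  · rw [LinearMap.sub_apply, LinearMap.flip_apply, ← neg_sub, h.comm]
    split_ifs <;> simp
  · split_ifs <;> simp [hf]

/-- If the adjoint representation is traceless, star commutators are total divergences. -/
theorem commutator_totalDiv (h : IsLieStar f μ) (hf : ∀ A, ∑ B, f A B B = 0) (k : ℕ)
    (q : MvPolynomial ι ℝ) : (μ k).flip q - μ k q ∈ totalDiv ι := by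
  -- The polynomial `q` is generalised because the corrections `μ_j(q, z_A)` at lower orders are not
  -- smaller polynomials.
  induction k using Nat.strong_induction_on generalizing q with
  | _ k ih =>
    induction q using MvPolynomial.induction_on with
    | C a =>
      rw [← mul_one (C a), ← smul_eq_C_mul, map_smul, map_smul]
      rw [show a • (μ k).flip 1 - a • μ k 1 = a • ((μ k).flip 1 - μ k 1) from
        (smul_sub _ _ _).symm]
      refine Submodule.smul_mem _ _ ?_
      have : (μ k).flip 1 - μ k 1 = 0 :=
        LinearMap.ext fun p => by simp [h.one_left, h.one_right]
      rw [this]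
      exact zero_mem _
    | add p q hp hq =>
      rw [map_add, map_add, add_sub_add_comm]; exact add_mem hp hq
    | mul_X q A hq =>
      have ih' : ∀ i ≤ k, (μ i).flip q - μ i q ∈ totalDiv ι := fun i hi =>
        hi.lt_or_eq.elim (fun hi => ih i hi q) fun hi => hi ▸ hq
      -- This is `[p, q ⋆ z] = [p ⋆ q, z] + [z ⋆ p, q]`, the term `z ⋆ p ⋆ q` being subtracted and
      -- added.
      have key : ∑ x ∈ antidiagonal k, ((μ x.1).flip (μ x.2 q (X A)) - μ x.1 (μ x.2 q (X A))) =
          ∑ x ∈ antidiagonal k, (((μ x.1).flip (X A) - μ x.1 (X A)) * (μ x.2).flip q +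
            ((μ x.1).flip q - μ x.1 q) * μ x.2 (X A)) := by
        refine LinearMap.ext fun p => ?_
        simp only [LinearMap.sum_apply, LinearMap.sub_apply, LinearMap.add_apply,
          Module.End.mul_apply, LinearMap.flip_apply, Finset.sum_sub_distrib,
          Finset.sum_add_distrib]
        rw [← h.assoc k p q (X A), h.assoc k q (X A) p, ← h.assoc k (X A) p q]
        abel
      have hR : ∀ x ∈ antidiagonal k, ((μ x.1).flip (X A) - μ x.1 (X A)) * (μ x.2).flip q +
            ((μ x.1).flip q - μ x.1 q) * μ x.2 (X A) ∈ totalDiv ι := by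
        intro x hx
        obtain ⟨N, hN⟩ := h.order_right x.2
        exact add_mem (totalDiv_mul_mem (h.generator_totalDiv hf _ _) ⟨N, hN q⟩)
          (totalDiv_mul_mem (ih' _ (by have := Finset.HasAntidiagonal.mem_antidiagonal.1 hx; omega))
            (linOp_le_diffOps (h.left_lin _ _)))
      have hS := sum_mem hR
      -- The summand with `i = k` is the commutator with `q z_A`, since `μ_0(q, z_A) = z_A q`; all
      -- others are divergences by induction.
      rw [← key, Finset.Nat.sum_antidiagonal_eq_sum_range_succ
        (fun i j => (μ i).flip (μ j q (X A)) - μ i (μ j q (X A))), Finset.sum_range_succ,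
        Nat.sub_self, h.zero_X, mul_comm] at hS
      exact (Submodule.add_mem_iff_right _
        (sum_mem fun i hi => ih i (Finset.mem_range.1 hi) _)).1 hS

end IsLieStar

end Star

open MeasureTheory

/-! ### Differential operators on smooth functions and integration by parts -/

section Calculus

variable {ι : Type*} [Fintype ι] [DecidableEq ι] {𝕜 : Type*} [RCLike 𝕜]

theorem contDiff_eval (p : MvPolynomial ι ℝ) :
    ContDiff ℝ ((⊤ : ℕ∞) : WithTop ℕ∞) fun z : ι → ℝ => eval z p := by
  induction p using MvPolynomial.induction_on with
  | C a => simpa using contDiff_const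
  | add p q hp hq => simpa using hp.add hq
  | mul_X p A hp => simpa using hp.mul (contDiff_apply ℝ ℝ A)

theorem fderiv_eval (p : MvPolynomial ι ℝ) (z : ι → ℝ) (A : ι) :
    fderiv ℝ (fun z : ι → ℝ => eval z p) z (Pi.single A 1) = eval z (pderiv A p) := by
  have hd : ∀ p : MvPolynomial ι ℝ, DifferentiableAt ℝ (fun z : ι → ℝ => eval z p) z :=
    fun p => (contDiff_eval p).differentiable (by simp) z
  induction p using MvPolynomial.induction_on with
  | C a => simp
  | add p q hp hq =>
    simp only [map_add]
    rw [fderiv_fun_add (hd p) (hd q), add_apply, hp, hq]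
  | mul_X p B hp =>
    simp only [map_mul, eval_X]
    rw [fderiv_fun_mul (hd p) (differentiableAt_apply B z)]
    have : fderiv ℝ (fun z : ι → ℝ => z B) z (Pi.single A 1) = if B = A then 1 else 0 := by
      rw [(hasFDerivAt_apply B z).fderiv]
      simp [Pi.single_apply]
    simp only [add_apply, smul_apply, this, hp,
      Derivation.leibniz, pderiv_X, smul_eq_mul, map_add, map_mul, eval_X, Pi.single_apply]
    congr 2
    split_ifs <;> simp

theorem contDiff_partialDeriv {f : (ι → ℝ) → 𝕜} (hf : ContDiff ℝ ((⊤ : ℕ∞) : WithTop ℕ∞) f)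
    (A : ι) : ContDiff ℝ ((⊤ : ℕ∞) : WithTop ℕ∞) (partialDeriv A f) :=
  (hf.fderiv_right (m := ((⊤ : ℕ∞) : WithTop ℕ∞)) (by simp)).clm_apply contDiff_const

theorem contDiff_iterPartial {f : (ι → ℝ) → 𝕜} (hf : ContDiff ℝ ((⊤ : ℕ∞) : WithTop ℕ∞) f)
    (I : List ι) : ContDiff ℝ ((⊤ : ℕ∞) : WithTop ℕ∞) (iterPartial I f) := by
  induction I with
  | nil => exact hf
  | cons A I ih => exact contDiff_partialDeriv ih A

theorem partialDeriv_comm {f : (ι → ℝ) → 𝕜} (hf : ContDiff ℝ ((⊤ : ℕ∞) : WithTop ℕ∞) f)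
    (A B : ι) : partialDeriv A (partialDeriv B f) = partialDeriv B (partialDeriv A f) := by
  have h : ∀ (A B : ι) (z : ι → ℝ), partialDeriv A (partialDeriv B f) z =
      fderiv ℝ (fderiv ℝ f) z (Pi.single A 1) (Pi.single B 1) := by
    intro A B z
    have hd : DifferentiableAt ℝ (fderiv ℝ f) z :=
      (hf.fderiv_right (m := ((⊤ : ℕ∞) : WithTop ℕ∞)) (by simp)).differentiable (by simp) z
    unfold partialDeriv
    rw [fderiv_clm_apply hd (differentiableAt_const _)]
    simp
  funext z
  rw [h, h]
  exact (hf.contDiffAt.isSymmSndFDerivAt (by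
    rw [minSmoothness_of_isRCLikeNormedField]; exact WithTop.coe_le_coe.2 le_top)) _ _

theorem iterPartial_wordSymm {f : (ι → ℝ) → 𝕜} (hf : ContDiff ℝ ((⊤ : ℕ∞) : WithTop ℕ∞) f) :
    WordSymm fun I => iterPartial I f := by
  intro I J h
  induction h with
  | nil => rfl
  | cons A _ ih => exact congrArg (partialDeriv A) ih
  | swap A B I => exact partialDeriv_comm (contDiff_iterPartial hf I) _ _
  | trans _ _ h1 h2 => exact h1.trans h2

/-- The value at `z` of the differential operator `∑ K, a_K ∂_K` applied to a function. -/
def symbFun (g : (ι → ℝ) → 𝕜) (z : ι → ℝ) : (List ι →₀ MvPolynomial ι ℝ) →ₗ[ℝ] 𝕜 :=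
  Finsupp.lsum ℝ fun K => (aeval z : MvPolynomial ι ℝ →ₐ[ℝ] ℝ).toLinearMap.smulRight
    (iterPartial K g z)

theorem symbFun_single (g : (ι → ℝ) → 𝕜) (z : ι → ℝ) (K : List ι) (a : MvPolynomial ι ℝ) :
    symbFun g z (Finsupp.single K a) = eval z a • iterPartial K g z := by
  simp [symbFun]

/-- The differential operator `∑ K, a_K ∂_K` applied to a polynomial. -/
def symbPoly (q : MvPolynomial ι ℝ) :
    (List ι →₀ MvPolynomial ι ℝ) →ₗ[ℝ] MvPolynomial ι ℝ :=
  Finsupp.lsum ℝ fun K => LinearMap.mulRight ℝ (derWord K q)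

theorem symbPoly_single (q : MvPolynomial ι ℝ) (K : List ι) (a : MvPolynomial ι ℝ) :
    symbPoly q (Finsupp.single K a) = a * derWord K q := by
  simp [symbPoly]

theorem pderiv_shiftedMonomial (z : ι → ℝ) (A : ι) (I : List ι) :
    pderiv A (shiftedMonomial z I) = wordRemove A (shiftedMonomial z) I := by
  suffices h : ∀ p : MvPolynomial ι ℝ, p * pderiv A (shiftedMonomial z I) =
      wordRemove A (fun J => p * shiftedMonomial z J) I by simpa using h 1
  induction I with
  | nil => intro p; simp [wordRemove, shiftedMonomial_nil]
  | cons B I ih =>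
    intro p
    simp only [wordRemove, shiftedMonomial_cons, ← mul_assoc]
    rw [← ih, Derivation.leibniz]
    simp only [map_sub, pderiv_X, pderiv_C, Pi.single_apply, smul_eq_mul, eq_comm (a := B)]
    split_ifs <;> simp <;> ring

/-- The polynomial with Taylor coefficients `F` at `z` has `∂_K`-derivative `F K` there, and only
its part of degree `|K|` contributes. -/
theorem wordSum_shiftedMonomial (z : ι → ℝ) (K : List ι) (n : ℕ) {F : List ι → 𝕜}
    (hF : WordSymm F) :
    (n.factorial : ℝ)⁻¹ •
      wordSum n (fun L => eval z (derWord K (shiftedMonomial z L)) • F L) =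
    if n = K.length then F K else 0 := by
  induction K generalizing n F with
  | nil =>
    rcases n with _ | n
    · simp [wordSum_zero, shiftedMonomial_nil]
    · rw [wordSum_eq_zero, smul_zero, if_neg (by simp)]
      intro L hL
      rcases L with _ | ⟨A, L⟩
      · simp at hL
      · simp [shiftedMonomial_cons]
  | cons A K ih =>
    simp only [derWord_cons, ← derWord_comm, Module.End.mul_apply, der_apply]
    rcases n with _ | n
    · simp [wordSum_zero, shiftedMonomial_nil]
    · simp only [pderiv_shiftedMonomial]
      have := wordSum_wordRemove (AddMonoidHom.mk' (fun p : MvPolynomial ι ℝ =>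
        AddMonoidHom.mk' (fun y : 𝕜 => eval z (derWord K p) • y) (fun y y' => smul_add _ _ _))
          (fun p q => AddMonoidHom.ext fun y => by simp [add_smul])) A n (shiftedMonomial z) F hF
      simp only [AddMonoidHom.mk'_apply] at this
      rw [this, ← Nat.cast_smul_eq_nsmul ℝ, smul_smul, Nat.factorial_succ]
      have e : ((((n + 1) * n.factorial : ℕ) : ℝ)⁻¹ * ((n + 1 : ℕ) : ℝ)) =
          (n.factorial : ℝ)⁻¹ := by
        push_cast
        field_simp
      rw [e, ih n (hF.cons A)]
      simp

/-- A differential operator that vanishes on polynomials vanishes on smooth functions. -/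
theorem symbFun_eq_zero {g : (ι → ℝ) → 𝕜} (hg : ContDiff ℝ ((⊤ : ℕ∞) : WithTop ℕ∞) g)
    {e : List ι →₀ MvPolynomial ι ℝ} (he : ∀ q, symbPoly q e = 0) (z : ι → ℝ) :
    symbFun g z e = 0 := by
  have hF : WordSymm fun K => iterPartial K g z :=
    fun I J h => congrFun (iterPartial_wordSymm hg I J h) z
  set M := e.support.sup List.length
  -- The value at `z` is that of the operator on the Taylor polynomial of `g` at `z`; degree `M`
  -- suffices because no word in `e` is longer.
  have h1 : symbFun g z e = ∑ n ∈ Finset.range (M + 1), (n.factorial : ℝ)⁻¹ •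
      wordSum n fun L => eval z (symbPoly (shiftedMonomial z L) e) • iterPartial L g z := by
    have h2 : ∀ (n : ℕ) (L : List ι), eval z (symbPoly (shiftedMonomial z L) e) •
        iterPartial L g z = ∑ K ∈ e.support, eval z (e K) •
          (eval z (derWord K (shiftedMonomial z L)) • iterPartial L g z) := by
      intro n L
      simp only [symbPoly, Finsupp.lsum_apply, Finsupp.sum, map_sum, Finset.sum_smul,
        LinearMap.mulRight_apply, map_mul, mul_smul]
    have h3 : ∀ n, (n.factorial : ℝ)⁻¹ • wordSum n (fun L =>
        eval z (symbPoly (shiftedMonomial z L) e) • iterPartial L g z) =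
        ∑ K ∈ e.support, eval z (e K) • if n = K.length then iterPartial K g z else 0 := by
      intro n
      simp only [h2 n]
      rw [wordSum, Finset.sum_comm, Finset.smul_sum]
      refine Finset.sum_congr rfl fun K _ => ?_
      rw [← wordSum_shiftedMonomial z K n hF, ← Finset.smul_sum, smul_comm]
      rfl
    simp only [h3]
    rw [Finset.sum_comm]
    simp only [symbFun, Finsupp.lsum_apply, Finsupp.sum]
    refine Finset.sum_congr rfl fun K hK => ?_
    rw [← Finset.smul_sum, Finset.sum_ite_eq', if_pos]
    · simp
    · exact Finset.mem_range.2 (Nat.lt_succ_of_le (Finset.le_sup hK))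
  rw [h1]
  refine Finset.sum_eq_zero fun n _ => ?_
  rw [wordSum_eq_zero, smul_zero]
  intro L _
  rw [he, map_zero, zero_smul]

/-- The operator `g ↦ (-1)^|I| ∂_I (a ∂_J g)`. -/
def adjSymb : List ι → MvPolynomial ι ℝ → List ι → (List ι →₀ MvPolynomial ι ℝ)
  | [], a, J => Finsupp.single J a
  | A :: I, a, J => - adjSymb I (pderiv A a) J - adjSymb I a (A :: J)

theorem symbPoly_adjSymb (q : MvPolynomial ι ℝ) (I : List ι) (a : MvPolynomial ι ℝ)
    (J : List ι) :
    symbPoly q (adjSymb I a J) = (-1 : ℝ) ^ I.length • derWord I (a * derWord J q) := by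
  induction I generalizing a J with
  | nil => simp [adjSymb, symbPoly_single]
  | cons A I ih =>
    rw [adjSymb, map_sub, map_neg, ih, ih, derWord_cons A J, derWord_cons A I, ← derWord_comm A I,
      Module.End.mul_apply, Module.End.mul_apply, der_apply, der_apply, Derivation.leibniz,
      map_add, List.length_cons, pow_succ, smul_eq_mul, smul_eq_mul,
      mul_comm (derWord J q)]
    module

/-- Every product of a polynomial and partial derivatives of `f` and `g` is integrable. -/
def JointIntegrable (f g : (ι → ℝ) → 𝕜) : Prop :=
  ∀ (I J : List ι) (p : MvPolynomial ι ℝ), Integrable fun z : ι → ℝ =>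
    eval z p • (iterPartial I f z * iterPartial J g z)

theorem JointIntegrable.symm {f g : (ι → ℝ) → 𝕜} (h : JointIntegrable f g) :
    JointIntegrable g f := by
  intro I J p
  simpa only [mul_comm] using h J I p

theorem JointIntegrable.mul_symbFun {f g : (ι → ℝ) → 𝕜} (h : JointIntegrable f g)
    (e : List ι →₀ MvPolynomial ι ℝ) : Integrable fun z => f z * symbFun g z e := by
  induction e using Finsupp.induction_linear with
  | zero => simp
  | add e e' he he' =>
    simp only [map_add, mul_add]
    exact he.add he'
  | single K a =>
    simp only [symbFun_single, mul_smul_comm]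
    exact h [] K a

theorem JointIntegrable.const_smul {f g : (ι → ℝ) → 𝕜} (h : JointIntegrable f g) (c : ℝ)
    (I J : List ι) (p : MvPolynomial ι ℝ) : Integrable fun z : ι → ℝ =>
      c • (eval z p • (iterPartial I f z * iterPartial J g z)) :=
  (h I J p).smul c

theorem JointIntegrable.const_smul_mul_symbFun {f g : (ι → ℝ) → 𝕜} (h : JointIntegrable f g)
    (c : ℝ) (e : List ι →₀ MvPolynomial ι ℝ) :
    Integrable fun z => c • (f z * symbFun g z e) :=
  (h.mul_symbFun e).smul c

/-- Integration by parts, one letter at a time. Joint integrability covers the integrand and every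
product produced on the way, so no separate decay condition is needed. Both `a` and `J` vary in the
induction, since the derivative falls on either factor. -/
theorem integral_adjSymb {f g : (ι → ℝ) → 𝕜} (hf : ContDiff ℝ ((⊤ : ℕ∞) : WithTop ℕ∞) f)
    (hg : ContDiff ℝ ((⊤ : ℕ∞) : WithTop ℕ∞) g) (h : JointIntegrable f g) (I : List ι)
    (a : MvPolynomial ι ℝ) (J : List ι) :
    ∫ z, eval z a • (iterPartial I f z * iterPartial J g z) =
      ∫ z, f z * symbFun g z (adjSymb I a J) := by
  induction I generalizing a J with
  | nil => simp [adjSymb, symbFun_single, iterPartial]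
  | cons A I ih =>
    have hG : ∀ z : ι → ℝ, fderiv ℝ (fun z => eval z a • iterPartial J g z) z (Pi.single A 1) =
        eval z (pderiv A a) • iterPartial J g z + eval z a • iterPartial (A :: J) g z := by
      intro z
      have h1 : DifferentiableAt ℝ (fun z : ι → ℝ => eval z a) z :=
        (contDiff_eval a).differentiable (by simp) z
      have h2 : DifferentiableAt ℝ (iterPartial J g) z :=
        (contDiff_iterPartial hg J).differentiable (by simp) z
      have := fderiv_fun_smul h1 h2
      rw [this]
      simp only [add_apply, smul_apply,
        ContinuousLinearMap.smulRight_apply, fderiv_eval]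
      rw [add_comm]
      rfl
    have hGd : Differentiable ℝ fun z => eval z a • iterPartial J g z :=
      ((contDiff_eval a).differentiable (by simp)).smul
        ((contDiff_iterPartial hg J).differentiable (by simp))
    have hFd : Differentiable ℝ (iterPartial I f) :=
      (contDiff_iterPartial hf I).differentiable (by simp)
    have e : ∀ z : ι → ℝ, (eval z (pderiv A a) • iterPartial J g z +
        eval z a • iterPartial (A :: J) g z) * iterPartial I f z =
        eval z (pderiv A a) • (iterPartial I f z * iterPartial J g z) +
          eval z a • (iterPartial I f z * iterPartial (A :: J) g z) := by
      intro z
      rw [add_mul, smul_mul_assoc, smul_mul_assoc, mul_comm (iterPartial J g z),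
        mul_comm (iterPartial (A :: J) g z)]
    have ibp := integral_mul_fderiv_eq_neg_fderiv_mul_of_integrable
      (μ := (volume : Measure (ι → ℝ))) (f := fun z => eval z a • iterPartial J g z)
      (g := iterPartial I f) (v := Pi.single A 1) (by
        simp only [hG, e]
        exact (h I J _).add (h I (A :: J) a)) (by
        have := h (A :: I) J a
        refine this.congr (Filter.Eventually.of_forall fun z => ?_)
        simp only [smul_mul_assoc, mul_comm (iterPartial J g z)]
        rfl) (by
        have := h I J a
        refine this.congr (Filter.Eventually.of_forall fun z => ?_)
        simp only [smul_mul_assoc, mul_comm (iterPartial J g z)]) (fun x _ => hGd x) (fun x _ => hFd x)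
    have h0 : ∫ z, eval z a • (iterPartial (A :: I) f z * iterPartial J g z) =
        ∫ z, eval z a • iterPartial J g z * fderiv ℝ (iterPartial I f) z (Pi.single A 1) := by
      refine integral_congr_ae (Filter.Eventually.of_forall fun z => ?_)
      simp only [smul_mul_assoc, mul_comm (iterPartial J g z)]
      rfl
    rw [h0, ibp]
    simp only [hG, e]
    rw [integral_add (h I J _) (h I (A :: J) a), ih, ih]
    simp only [adjSymb, map_sub, map_neg, mul_sub, mul_neg]
    rw [integral_sub (f := fun z => -(f z * symbFun g z _)) (h.mul_symbFun _).neg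
      (h.mul_symbFun _), integral_neg, neg_add, sub_eq_add_neg]

end Calculus

/-! ### Bidifferential operators and their integrals -/

section Bidiff

variable {ι : Type*} [Fintype ι] [DecidableEq ι] {𝕜 : Type*} [RCLike 𝕜]

/-- The coefficient of `∂_I ⊗ ∂_J / (|I|! |J|!)` in a bilinear operator on polynomials. -/
def bisymb (μ : MvPolynomial ι ℝ →ₗ[ℝ] Module.End ℝ (MvPolynomial ι ℝ)) (I J : List ι) :
    MvPolynomial ι ℝ :=
  symb I (symb J ∘ₗ μ)

theorem eval_bisymb (μ : MvPolynomial ι ℝ →ₗ[ℝ] Module.End ℝ (MvPolynomial ι ℝ)) (z : ι → ℝ)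
    (I J : List ι) : eval z (bisymb μ I J) =
      eval z (μ (shiftedMonomial z I) (shiftedMonomial z J)) := by
  rw [bisymb, ← eval_shiftedMonomial, LinearMap.comp_apply, ← eval_shiftedMonomial]

/-- The definition treats the two arguments asymmetrically, but the values in `eval_bisymb` do not.
-/
theorem bisymb_flip (μ : MvPolynomial ι ℝ →ₗ[ℝ] Module.End ℝ (MvPolynomial ι ℝ))
    (I J : List ι) : bisymb (LinearMap.flip μ) I J = bisymb μ J I :=
  MvPolynomial.funext fun z => by rw [eval_bisymb, eval_bisymb, LinearMap.flip_apply]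

/-- Commutators in the second argument only replace `q` by `X A * q` or multiply the result by `X
A`, so the order in the first argument is unaffected. -/
theorem symb_comp_mem_diffOp {N : ℕ}
    {μ : MvPolynomial ι ℝ →ₗ[ℝ] Module.End ℝ (MvPolynomial ι ℝ)}
    (h : ∀ q, LinearMap.flip μ q ∈ diffOp N) (J : List ι) : symb J ∘ₗ μ ∈ diffOp N := by
  induction J generalizing μ with
  | nil => exact h 1
  | cons A J ih =>
    refine ih (μ := adX A ∘ₗ μ) fun q => ?_
    have : LinearMap.flip (adX A ∘ₗ μ) q =
        LinearMap.flip μ (X A * q) - LinearMap.mulLeft ℝ (X A) * LinearMap.flip μ q := rfl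
    rw [this]
    exact sub_mem (h _) (mulLeft_mul_mem_diffOp _ (h q))

theorem bisymb_eq_zero {N : ℕ} {μ : MvPolynomial ι ℝ →ₗ[ℝ] Module.End ℝ (MvPolynomial ι ℝ)}
    (h1 : ∀ p, μ p ∈ diffOp N) (h2 : ∀ q, LinearMap.flip μ q ∈ diffOp N) {I J : List ι}
    (h : N ≤ I.length ∨ N ≤ J.length) : bisymb μ I J = 0 := by
  rcases h with h | h
  · exact symb_eq_zero (symb_comp_mem_diffOp h2 J) h
  · have : symb J ∘ₗ μ = 0 := LinearMap.ext fun p => symb_eq_zero (h1 p) h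
    rw [bisymb, this, map_zero]

/-- The extension to functions of a bilinear operator on polynomials. -/
def bidiffExt (μ : MvPolynomial ι ℝ →ₗ[ℝ] Module.End ℝ (MvPolynomial ι ℝ))
    (f g : (ι → ℝ) → 𝕜) : (ι → ℝ) → 𝕜 := fun z =>
  ∑ᶠ mn : ℕ × ℕ, ∑ I : Fin mn.1 → ι, ∑ J : Fin mn.2 → ι,
    ((mn.1.factorial : ℝ)⁻¹ * (mn.2.factorial : ℝ)⁻¹ *
      eval z (μ (shiftedMonomial z (List.ofFn I)) (shiftedMonomial z (List.ofFn J)))) •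
      (iterPartial (List.ofFn I) f z * iterPartial (List.ofFn J) g z)

variable {μ : MvPolynomial ι ℝ →ₗ[ℝ] Module.End ℝ (MvPolynomial ι ℝ)} {N : ℕ}

/-- The order bounds give the `finsum` finite support; otherwise it could take its default value
`0`. -/
theorem bidiffExt_eq (h1 : ∀ p, μ p ∈ diffOp N) (h2 : ∀ q, LinearMap.flip μ q ∈ diffOp N)
    (f g : (ι → ℝ) → 𝕜) (z : ι → ℝ) : bidiffExt μ f g z =
      ∑ mn ∈ Finset.range N ×ˢ Finset.range N, wordSum mn.1 fun I => wordSum mn.2 fun J =>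
        ((mn.1.factorial : ℝ)⁻¹ * (mn.2.factorial : ℝ)⁻¹) • (eval z (bisymb μ I J) •
          (iterPartial I f z * iterPartial J g z)) := by
  unfold bidiffExt
  simp only [← eval_bisymb, mul_smul]
  refine finsum_eq_sum_of_support_subset _ fun mn hmn => ?_
  contrapose! hmn
  rw [Function.notMem_support]
  refine Finset.sum_eq_zero fun I _ => Finset.sum_eq_zero fun J _ => ?_
  rw [bisymb_eq_zero h1 h2]
  · simp
  · simp only [List.length_ofFn]
    simp at hmn
    by_cases h : N ≤ mn.1
    · exact Or.inl h
    · exact Or.inr (hmn (by omega))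

theorem bidiffExt_swap (h1 : ∀ p, μ p ∈ diffOp N) (h2 : ∀ q, LinearMap.flip μ q ∈ diffOp N)
    (f g : (ι → ℝ) → 𝕜) : bidiffExt μ g f = bidiffExt (LinearMap.flip μ) f g := by
  funext z
  rw [bidiffExt_eq h1 h2, bidiffExt_eq (μ := LinearMap.flip μ) h2 h1, Finset.sum_product_right,
    Finset.sum_product]
  refine Finset.sum_congr rfl fun m _ => Finset.sum_congr rfl fun n _ => ?_
  unfold wordSum
  rw [Finset.sum_comm]
  refine Finset.sum_congr rfl fun I _ => Finset.sum_congr rfl fun J _ => ?_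
  dsimp only
  rw [bisymb_flip, mul_comm (iterPartial _ f z), mul_comm ((n.factorial : ℝ)⁻¹)]

theorem integrable_bidiffExt (h1 : ∀ p, μ p ∈ diffOp N)
    (h2 : ∀ q, LinearMap.flip μ q ∈ diffOp N) {f g : (ι → ℝ) → 𝕜} (h : JointIntegrable f g) :
    Integrable (bidiffExt μ f g) := by
  rw [funext (bidiffExt_eq h1 h2 f g)]
  exact integrable_finsetSum _ fun mn _ => integrable_finsetSum _ fun I _ =>
    integrable_finsetSum _ fun J _ => h.const_smul _ _ _ _

theorem integral_bidiffExt (h1 : ∀ p, μ p ∈ diffOp N)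
    (h2 : ∀ q, LinearMap.flip μ q ∈ diffOp N) {f g : (ι → ℝ) → 𝕜}
    (hf : ContDiff ℝ ((⊤ : ℕ∞) : WithTop ℕ∞) f) (hg : ContDiff ℝ ((⊤ : ℕ∞) : WithTop ℕ∞) g)
    (h : JointIntegrable f g) : ∫ z, bidiffExt μ f g z = ∫ z, f z * symbFun g z
      (∑ mn ∈ Finset.range N ×ˢ Finset.range N, wordSum mn.1 fun I => wordSum mn.2 fun J =>
        ((mn.1.factorial : ℝ)⁻¹ * (mn.2.factorial : ℝ)⁻¹) • adjSymb I (bisymb μ I J) J) := by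
  simp only [bidiffExt_eq h1 h2, wordSum, map_sum, map_smul, Finset.mul_sum, mul_smul_comm]
  rw [integral_finsetSum _ fun mn _ => integrable_finsetSum _ fun I _ =>
    integrable_finsetSum _ fun J _ => h.const_smul _ _ _ _,
    integral_finsetSum _ fun mn _ => integrable_finsetSum _ fun I _ =>
    integrable_finsetSum _ fun J _ => h.const_smul_mul_symbFun _ _]
  refine Finset.sum_congr rfl fun mn _ => ?_
  rw [integral_finsetSum _ fun I _ => integrable_finsetSum _ fun J _ => h.const_smul _ _ _ _,
    integral_finsetSum _ fun I _ =>
      integrable_finsetSum _ fun J _ => h.const_smul_mul_symbFun _ _]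
  refine Finset.sum_congr rfl fun I _ => ?_
  rw [integral_finsetSum _ fun J _ => h.const_smul _ _ _ _,
    integral_finsetSum _ fun J _ => h.const_smul_mul_symbFun _ _]
  refine Finset.sum_congr rfl fun J _ => ?_
  rw [integral_smul, integral_smul, integral_adjSymb hf hg h]

theorem adjSymb_sub (I : List ι) (a b : MvPolynomial ι ℝ) (J : List ι) :
    adjSymb I (a - b) J = adjSymb I a J - adjSymb I b J := by
  induction I generalizing a b J with
  | nil => simp [adjSymb]
  | cons A I ih => simp only [adjSymb, map_sub, ih]; abel

/-- If the commutators of a bidifferential operator are total divergences, then it is symmetric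
under the integral. -/
theorem integral_bidiffExt_comm (h1 : ∀ p, μ p ∈ diffOp N)
    (h2 : ∀ q, LinearMap.flip μ q ∈ diffOp N)
    (h3 : ∀ q, LinearMap.flip μ q - μ q ∈ totalDiv ι) {f g : (ι → ℝ) → 𝕜}
    (hf : ContDiff ℝ ((⊤ : ℕ∞) : WithTop ℕ∞) f) (hg : ContDiff ℝ ((⊤ : ℕ∞) : WithTop ℕ∞) g)
    (h : JointIntegrable f g) :
    ∫ z, bidiffExt μ f g z = ∫ z, bidiffExt μ g f z := by
  rw [bidiffExt_swap h1 h2 f g, integral_bidiffExt h1 h2 hf hg h,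
    integral_bidiffExt (μ := LinearMap.flip μ) h2 h1 hf hg h]
  refine integral_congr_ae (Filter.Eventually.of_forall fun z => ?_)
  dsimp only
  -- It remains to show that the difference of the two operators acting on `g` kills every
  -- polynomial `q`.
  rw [← sub_eq_zero, ← mul_sub, ← map_sub, symbFun_eq_zero hg, mul_zero]
  intro q
  obtain ⟨N₀, hN₀⟩ := adjOne_totalDiv (h3 q)
  have hq : LinearMap.flip μ q - μ q ∈ diffOp N := sub_mem (h2 q) (h1 q)
  have hz : adjOne N (LinearMap.flip μ q - μ q) = 0 := by
    rw [← adjOne_eq hq (le_max_left N N₀), hN₀ _ (le_max_right N N₀)]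
  -- Each symbol of the commutator with `q` is itself a differential operator applied to `q`, with
  -- coefficients given by the bisymbols. Thus `adjOne` of this commutator is the required value at
  -- `q`.
  have hs : ∀ I : List ι, symb I (LinearMap.flip μ q - μ q) = ∑ n ∈ Finset.range N,
      ((n.factorial : ℝ)⁻¹) • wordSum n fun J =>
        (bisymb μ I J - bisymb (LinearMap.flip μ) I J) * derWord J q := by
    intro I
    have hS : symb I ∘ₗ (LinearMap.flip μ - μ) ∈ diffOp N :=
      symb_comp_mem_diffOp (fun p => sub_mem (h1 p) (h2 p)) I
    have := apply_eq_sum_symb hS q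
    rw [LinearMap.comp_apply, LinearMap.sub_apply] at this
    rw [this]
    refine Finset.sum_congr rfl fun n _ => ?_
    congr 2
    funext J
    rw [bisymb_flip, ← bisymb_flip μ J I, LinearMap.comp_sub, map_sub]
    rfl
  rw [← hz, adjOne]
  simp only [hs]
  rw [← Finset.sum_sub_distrib, map_sum, Finset.sum_product]
  refine Finset.sum_congr rfl fun m _ => ?_
  simp only [wordSum, map_sum, map_smul, ← Finset.sum_sub_distrib, ← smul_sub, ← adjSymb_sub,
    symbPoly_adjSymb, List.length_ofFn, Finset.smul_sum]
  rw [Finset.sum_comm]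
  refine Finset.sum_congr rfl fun I _ => Finset.sum_congr rfl fun n _ =>
    Finset.sum_congr rfl fun J _ => ?_
  rw [smul_smul, smul_smul]
  congr 1
  ring

end Bidiff

open Finset.HasAntidiagonal

/-! ### Polynomials of bounded degree -/

section Degree

variable {ι : Type*}

/-- The polynomials of degree less than `n`. -/
def degLT (ι : Type*) (n : ℕ) : Submodule ℝ (MvPolynomial ι ℝ) where
  carrier := {p | ∀ α : ι →₀ ℕ, n ≤ α.degree → coeff α p = 0}
  add_mem' := by
    intro p q hp hq α hα
    rw [coeff_add, hp α hα, hq α hα, add_zero]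
  zero_mem' := fun _ _ => coeff_zero _
  smul_mem' := by
    intro r p hp α hα
    rw [coeff_smul, hp α hα, smul_zero]

theorem degLT_mono {m n : ℕ} (h : m ≤ n) : degLT ι m ≤ degLT ι n :=
  fun _ hp α hα => hp α (h.trans hα)

theorem exists_mem_degLT (p : MvPolynomial ι ℝ) : ∃ n, p ∈ degLT ι n := by
  refine ⟨p.support.sup Finsupp.degree + 1, fun α hα => ?_⟩
  by_contra h
  have := Finset.le_sup (f := Finsupp.degree) (mem_support_iff.2 h)
  omega

theorem pderiv_mem_degLT {n : ℕ} {p : MvPolynomial ι ℝ} (hp : p ∈ degLT ι (n + 1)) (A : ι) :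
    pderiv A p ∈ degLT ι n := by
  intro α hα
  rw [coeff_pderiv, hp, zero_mul]
  rw [map_add, Finsupp.degree_single]
  omega

theorem X_mul_mem_degLT {n : ℕ} {p : MvPolynomial ι ℝ} (hp : p ∈ degLT ι n) (A : ι) :
    X A * p ∈ degLT ι (n + 1) := by
  classical
  intro α hα
  rw [coeff_X_mul']
  split_ifs with h
  · refine hp _ ?_
    have h1 : α - Finsupp.single A 1 + Finsupp.single A 1 = α := by
      refine tsub_add_cancel_of_le (Finsupp.single_le_iff.2 ?_)
      exact Nat.one_le_iff_ne_zero.2 (Finsupp.mem_support_iff.1 h)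
    have h2 := congrArg Finsupp.degree h1
    rw [map_add, Finsupp.degree_single] at h2
    omega
  · rfl

theorem constOp_mem_degLT {n : ℕ} {p : MvPolynomial ι ℝ} (hp : p ∈ degLT ι n)
    {K : Module.End ℝ (MvPolynomial ι ℝ)} (hK : K ∈ constOp ι) : K p ∈ degLT ι n := by
  induction hK using Algebra.adjoin_induction generalizing p with
  | mem x hx =>
    obtain ⟨A, rfl⟩ := hx
    exact pderiv_mem_degLT (degLT_mono n.le_succ hp) A
  | algebraMap r =>
    rw [Algebra.algebraMap_eq_smul_one]
    exact Submodule.smul_mem _ _ hp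
  | add x y _ _ hx hy => exact add_mem (hx hp) (hy hp)
  | mul x y _ _ hx hy => exact hx (hy hp)

end Degree

/-! ### Power series with coefficients in a polynomial ring -/

section Series

variable {σ : Type*}

theorem coeff_series_smul (r : PowerSeries ℝ) (F : PowerSeries (MvPolynomial σ ℝ)) (k : ℕ) :
    PowerSeries.coeff k (r • F) = ∑ x ∈ antidiagonal k,
      PowerSeries.coeff x.1 r • PowerSeries.coeff x.2 F := by
  rw [Algebra.smul_def, PowerSeries.algebraMap_apply'', PowerSeries.coeff_mul]
  refine Finset.sum_congr rfl fun x _ => ?_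
  rw [PowerSeries.coeff_map, ← Algebra.smul_def]

theorem X_series_smul (F : PowerSeries (MvPolynomial σ ℝ)) :
    (PowerSeries.X : PowerSeries ℝ) • F = PowerSeries.X * F := by
  rw [Algebra.smul_def, PowerSeries.algebraMap_apply'', PowerSeries.map_X]

theorem C_series_smul (c : ℝ) (F : PowerSeries (MvPolynomial σ ℝ)) (k : ℕ) :
    PowerSeries.coeff k ((PowerSeries.C c : PowerSeries ℝ) • F) =
      c • PowerSeries.coeff k F := by
  rw [Algebra.smul_def, PowerSeries.algebraMap_apply'', PowerSeries.map_C,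
    PowerSeries.coeff_C_mul, ← Algebra.smul_def]

theorem eq_C_add_X_mul (F : PowerSeries (MvPolynomial σ ℝ)) :
    F = PowerSeries.C (PowerSeries.coeff 0 F) +
      PowerSeries.X * PowerSeries.mk fun n => PowerSeries.coeff (n + 1) F := by
  conv_lhs => rw [PowerSeries.eq_X_mul_shift_add_const F]
  rw [add_comm]
  simp

/-- Splitting off `F_0` and dividing the rest by `λ` reduces order `k + 1` to order `k`, so
compatibility with `λ` replaces any continuity assumption. -/
theorem coeff_map_series {τ : Type*}
    (T : PowerSeries (MvPolynomial σ ℝ) →+ PowerSeries (MvPolynomial τ ℝ))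
    (hT : ∀ F, T (PowerSeries.X * F) = PowerSeries.X * T F) (k : ℕ)
    (F : PowerSeries (MvPolynomial σ ℝ)) :
    PowerSeries.coeff k (T F) = ∑ x ∈ antidiagonal k,
      PowerSeries.coeff x.1 (T (PowerSeries.C (PowerSeries.coeff x.2 F))) := by
  induction k generalizing F with
  | zero =>
    conv_lhs => rw [eq_C_add_X_mul F]
    simp [hT]
  | succ k ih =>
    conv_lhs => rw [eq_C_add_X_mul F]
    rw [map_add, map_add, hT, PowerSeries.coeff_succ_X_mul, ih,
      Finset.Nat.antidiagonal_succ']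
    simp

theorem coeffDeriv_C (B : σ) (p : MvPolynomial σ ℝ) :
    coeffDeriv B (PowerSeries.C p) = PowerSeries.C (pderiv B p) := by
  ext1 n
  simp only [coeffDeriv, PowerSeries.coeff_mk, PowerSeries.coeff_C]
  split_ifs <;> simp

end Series

/-! ### Right multiplication in the enveloping algebra -/

section RightMul

variable {ι : Type*} [Fintype ι] [DecidableEq ι]
variable {𝔤 : Type*} [LieRing 𝔤] [LieAlgebra ℝ 𝔤] {b : Module.Basis ι ℝ 𝔤}

/-- The generators `ẑ_A` of the enveloping algebra. -/
def gen (b : Module.Basis ι ℝ 𝔤) (A : ι) : EnvAlg b :=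
  RingQuot.mkAlgHom (PowerSeries ℝ) (EnvRel b) (FreeAlgebra.ι (PowerSeries ℝ) A)

theorem gen_mul_gen (A B : ι) : gen b A * gen b B = gen b B * gen b A +
    ∑ C, (PowerSeries.X * PowerSeries.C (structureConst b A B C) : PowerSeries ℝ) • gen b C := by
  have := RingQuot.mkAlgHom_rel (PowerSeries ℝ) (EnvRel.comm (b := b) A B)
  simp only [map_mul, map_add, map_sum, map_smul] at this
  exact this

theorem envAlg_induction {motive : EnvAlg b → Prop}
    (scalar : ∀ r, motive (algebraMap (PowerSeries ℝ) _ r)) (gen : ∀ A, motive (gen b A))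
    (mul : ∀ u v, motive u → motive v → motive (u * v))
    (add : ∀ u v, motive u → motive v → motive (u + v)) (u : EnvAlg b) : motive u := by
  obtain ⟨x, rfl⟩ := RingQuot.mkAlgHom_surjective (PowerSeries ℝ) (EnvRel b) u
  induction x using FreeAlgebra.induction with
  | grade0 r => rw [AlgHom.commutes]; exact scalar r
  | grade1 A => exact gen A
  | mul a b ha hb => rw [map_mul]; exact mul _ _ ha hb
  | add a b ha hb => rw [map_add]; exact add _ _ ha hb

theorem substZ_gen (Z : LeftInvariantFrame b) (A : ι) : substZ Z (gen b A) = fieldMul Z A := by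
  rw [substZ, gen, RingQuot.liftAlgHom_mkAlgHom_apply, FreeAlgebra.lift_ι_apply]

/-- It is applied to right multiplications, which commute with every left multiplication. -/
theorem substZ_commute (Z : LeftInvariantFrame b)
    {T : Module.End (PowerSeries ℝ) (NormalOrdered ι)}
    (hT : ∀ A, fieldMul Z A * T = T * fieldMul Z A) (u : EnvAlg b) :
    substZ Z u * T = T * substZ Z u := by
  induction u using envAlg_induction with
  | scalar r => rw [AlgHom.commutes]; exact Algebra.commutes _ _
  | gen A => rw [substZ_gen, hT]
  | mul u v hu hv => rw [map_mul, mul_assoc, hv, ← mul_assoc, hu, mul_assoc]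
  | add u v hu hv => rw [map_add, add_mul, mul_add, hu, hv]

theorem coeffDeriv_inr_zetaFun (B : ι) (p : PowerSeries (MvPolynomial ι ℝ)) :
    coeffDeriv (Sum.inr B) (zetaFun p) = 0 := by
  ext1 n
  simp only [coeffDeriv, zetaFun, PowerSeries.coeff_mk, PowerSeries.coeff_map, map_zero]
  generalize PowerSeries.coeff n p = q
  change pderiv (Sum.inr B) (rename Sum.inl q) = 0
  induction q using MvPolynomial.induction_on with
  | C a => simp
  | add p q hp hq => simp [hp, hq]
  | mul_X p A hp => simp [Derivation.leibniz, hp, pderiv_X]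

/-- Right multiplication of a normally ordered expression by `z_B`. -/
def mulRightZ (B : ι) : Module.End (PowerSeries ℝ) (NormalOrdered ι) :=
  LinearMap.mulRight (PowerSeries ℝ) (PowerSeries.C (X (Sum.inr B)))

theorem mulRightZ_apply (B : ι) (F : NormalOrdered ι) :
    mulRightZ B F = F * PowerSeries.C (X (Sum.inr B)) := rfl

/-- Right multiplication of a normally ordered expression by `ζ^B`, brought to normal order. -/
def mulRightZeta (B : ι) : Module.End (PowerSeries ℝ) (NormalOrdered ι) where
  toFun F := PowerSeries.C (X (Sum.inl B)) * F + coeffDeriv (Sum.inr B) F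
  map_add' F G := by rw [coeffDeriv_add]; ring
  map_smul' r F := by rw [coeffDeriv_smul, RingHom.id_apply, smul_add, mul_smul_comm]

theorem mulRightZeta_apply (B : ι) (F : NormalOrdered ι) :
    mulRightZeta B F = PowerSeries.C (X (Sum.inl B)) * F + coeffDeriv (Sum.inr B) F := rfl

theorem substZ_mulRightZ (Z : LeftInvariantFrame b) (B : ι) (u : EnvAlg b)
    (F : NormalOrdered ι) : substZ Z u (mulRightZ B F) = mulRightZ B (substZ Z u F) := by
  refine LinearMap.congr_fun (substZ_commute Z (T := mulRightZ B) (fun A => ?_) u) F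
  refine LinearMap.ext fun G => ?_
  simp only [Module.End.mul_apply, fieldMul_apply, map_sum]
  refine Finset.sum_congr rfl fun D _ => ?_
  simp only [mulRightZ_apply, zMul_apply, coeffDeriv_mul, coeffDeriv_C]
  simp [pderiv_X]
  ring

/-- Associativity of normal ordering: the delta from `z_D ζ^B` on the left matches the one from
`∂/∂z_B` acting on the factor `z_D`. -/
theorem substZ_mulRightZeta (Z : LeftInvariantFrame b) (B : ι) (u : EnvAlg b)
    (F : NormalOrdered ι) : substZ Z u (mulRightZeta B F) = mulRightZeta B (substZ Z u F) := by
  refine LinearMap.congr_fun (substZ_commute Z (T := mulRightZeta B) (fun A => ?_) u) F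
  refine LinearMap.ext fun G => ?_
  simp only [Module.End.mul_apply, fieldMul_apply, map_sum]
  refine Finset.sum_congr rfl fun D _ => ?_
  simp only [mulRightZeta_apply, zMul_apply, coeffDeriv_add, coeffDeriv_mul, coeffDeriv_C,
    coeffDeriv_inr_zetaFun, coeffDeriv_comm (Sum.inl D) (Sum.inr B)]
  simp only [pderiv_X, Pi.single_apply, Sum.inl.injEq, Sum.inr.injEq, eq_comm (a := B)]
  split_ifs <;> simp <;> ring

theorem coeff_setZetaZero (F : NormalOrdered ι) (k : ℕ) :
    PowerSeries.coeff k (setZetaZero F) = aeval (Sum.elim (fun _ : ι => (0 : MvPolynomial ι ℝ)) X)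
      (PowerSeries.coeff k F) := by
  simp [setZetaZero]

/-- Normal ordering gives `F ζ^B = ζ^B F + ∂F/∂z_B`, and the first term dies at `ζ = 0`. -/
theorem setZetaZero_mulRightZeta (B : ι) (F : NormalOrdered ι) :
    setZetaZero (mulRightZeta B F) = coeffDeriv B (setZetaZero F) := by
  ext1 k
  rw [coeff_setZetaZero, mulRightZeta_apply, map_add, PowerSeries.coeff_C_mul]
  simp only [coeffDeriv, PowerSeries.coeff_mk, coeff_setZetaZero, map_add, map_mul, aeval_X,
    Sum.elim_inl, zero_mul, zero_add]
  generalize PowerSeries.coeff k F = q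
  induction q using MvPolynomial.induction_on with
  | C a => simp
  | add p q hp hq => simp only [map_add, hp, hq]
  | mul_X p A hp =>
    rcases A with A | A
    · simp [-aeval_eq_bind₁, Derivation.leibniz, hp, pderiv_X]
    · simp only [Derivation.leibniz, map_add, smul_eq_mul, map_mul, hp, aeval_X, Sum.elim_inr,
        pderiv_X, Pi.single_apply, Sum.inr.injEq]
      split_ifs <;> simp

theorem setZetaZero_smul (r : PowerSeries ℝ) (F : NormalOrdered ι) :
    setZetaZero (r • F) = r • setZetaZero F := by
  ext1 k
  simp only [coeff_setZetaZero, coeff_series_smul, map_sum, map_smul]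

theorem Omega_add (Z : LeftInvariantFrame b) (u v : EnvAlg b) :
    Omega Z (u + v) = Omega Z u + Omega Z v := by
  simp [Omega]

theorem Omega_smul (Z : LeftInvariantFrame b) (r : PowerSeries ℝ) (u : EnvAlg b) :
    Omega Z (r • u) = r • Omega Z u := by
  rw [Omega, map_smul, LinearMap.smul_apply, setZetaZero_smul]; rfl

theorem Omega_one (Z : LeftInvariantFrame b) : Omega Z 1 = 1 := by
  simp [Omega]

/-- The map `Ω` as a linear map. -/
def omegaLin (Z : LeftInvariantFrame b) :
    EnvAlg b →ₗ[PowerSeries ℝ] PowerSeries (MvPolynomial ι ℝ) where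
  toFun := Omega Z
  map_add' := Omega_add Z
  map_smul' := Omega_smul Z

theorem omegaLin_apply (Z : LeftInvariantFrame b) (u : EnvAlg b) :
    omegaLin Z u = Omega Z u := rfl

/-- Functions of `ζ` to the right of `f̂(Z)` act on `Ω(f̂)` as differential operators with constant
coefficients. -/
theorem exists_constOp (Z : LeftInvariantFrame b) (q : MvPolynomial ι ℝ) :
    ∃ K ∈ constOp ι,
      (∀ n, ∀ p ∈ degLT ι (n + 1), K p - constantCoeff q • p ∈ degLT ι n) ∧
      ∀ u k, PowerSeries.coeff k (setZetaZero (substZ Z u (zetaFun (PowerSeries.C q)))) =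
        K (PowerSeries.coeff k (Omega Z u)) := by
  induction q using MvPolynomial.induction_on with
  | C a =>
    refine ⟨a • 1, Subalgebra.smul_mem _ (one_mem _) _, fun n p _ => by simp, fun u k => ?_⟩
    have h : zetaFun (PowerSeries.C (C a) : PowerSeries (MvPolynomial ι ℝ)) =
        (PowerSeries.C a : PowerSeries ℝ) • 1 := by
      rw [Algebra.smul_def, PowerSeries.algebraMap_apply'']
      simp [zetaFun, MvPolynomial.algebraMap_eq]
    rw [h, map_smul, setZetaZero_smul, C_series_smul]
    rfl
  | add p q hp hq =>
    obtain ⟨K, hK, hd, h⟩ := hp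
    obtain ⟨K', hK', hd', h'⟩ := hq
    refine ⟨K + K', add_mem hK hK', fun n r hr => ?_, fun u k => ?_⟩
    · rw [LinearMap.add_apply, map_add, add_smul, add_sub_add_comm]
      exact add_mem (hd n r hr) (hd' n r hr)
    · rw [map_add, map_add, map_add, map_add, map_add, h, h', LinearMap.add_apply]
  | mul_X q A hq =>
    obtain ⟨K, hK, _, h⟩ := hq
    -- An extra factor `ζ^A` becomes an extra `∂_A`, which lowers the degree in accordance with its
    -- zero constant term.
    refine ⟨der A * K, mul_mem (der_mem_constOp A) hK, fun n p hp => ?_, fun u k => ?_⟩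
    · rw [map_mul, constantCoeff_X, mul_zero, zero_smul, sub_zero]
      exact pderiv_mem_degLT (constOp_mem_degLT hp hK) A
    · have e : zetaFun (PowerSeries.C (q * X A)) = mulRightZeta A (zetaFun (PowerSeries.C q)) := by
        rw [mulRightZeta_apply, coeffDeriv_inr_zetaFun, add_zero, map_mul, map_mul, mul_comm]
        simp [zetaFun]
      rw [e, substZ_mulRightZeta, setZetaZero_mulRightZeta, Module.End.mul_apply, ← h]
      simp [coeffDeriv]

/-- A `z_B` on the far right is already in normal order and is unaffected by setting `ζ = 0`. -/
theorem Omega_mul_gen (Z : LeftInvariantFrame b) (A : ι) (u : EnvAlg b) :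
    Omega Z (u * gen b A) = ∑ B, setZetaZero (substZ Z u (zetaFun (Z.ψ A B))) *
      PowerSeries.C (X B) := by
  have h1 : fieldMul Z A 1 = ∑ B, mulRightZ B (zetaFun (Z.ψ A B)) := by
    rw [fieldMul_apply]
    refine Finset.sum_congr rfl fun B _ => ?_
    rw [zMul_apply, mulRightZ_apply, ← map_one PowerSeries.C, coeffDeriv_C]
    simp
  rw [Omega, map_mul, Module.End.mul_apply, substZ_gen, h1, map_sum, map_sum]
  refine Finset.sum_congr rfl fun B _ => ?_
  rw [substZ_mulRightZ, mulRightZ_apply, map_mul]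
  simp [setZetaZero]

/-- The operators of right multiplication by the generators. -/
theorem exists_rightMul (Z : LeftInvariantFrame b) :
    ∃ R : ι → ℕ → Module.End ℝ (MvPolynomial ι ℝ), (∀ A i, R A i ∈ linOp ι) ∧
      (∀ A i n, ∀ p ∈ degLT ι (n + 1), R A i p - (if i = 0 then X A * p else 0) ∈
        degLT ι (n + 1)) ∧
      (∀ A u k, PowerSeries.coeff k (Omega Z (u * gen b A)) = ∑ x ∈ antidiagonal k,
        R A x.1 (PowerSeries.coeff x.2 (Omega Z u))) ∧
      ∀ A u, R A 0 (PowerSeries.coeff 0 (Omega Z u)) =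
        X A * PowerSeries.coeff 0 (Omega Z u) := by
  choose K hK hd h using exists_constOp Z
  have h0 : ∀ A B, PowerSeries.coeff 0 (Z.ψ A B) = if A = B then 1 else 0 := fun A B => by
    rw [PowerSeries.coeff_zero_eq_constantCoeff_apply, Z.limit]
  -- The operators are `∑ z_B ψ_A^B(∂)`, order by order. The value `ψ(0) = δ` controls the leading
  -- degree, and the limit `λ = 0` controls order zero.
  refine ⟨fun A i => ∑ B, mulX B * K (PowerSeries.coeff i (Z.ψ A B)),
    fun A i => sum_mem fun B _ => mulX_mul_mem_linOp B (hK _), ?_, ?_, ?_⟩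
  · intro A i n p hp
    have h1 : ∀ B, constantCoeff (PowerSeries.coeff i (Z.ψ A B)) =
        if i = 0 ∧ A = B then 1 else 0 := by
      intro B
      have := congrArg (PowerSeries.coeff i) (Z.counit A B)
      rw [PowerSeries.coeff_map] at this
      rw [this]
      by_cases hA : A = B <;> simp [hA, PowerSeries.coeff_one]
    have h2 : (if i = 0 then X A * p else 0) =
        ∑ B, X B * (constantCoeff (PowerSeries.coeff i (Z.ψ A B)) • p) := by
      simp only [h1]
      by_cases hi : i = 0 <;> simp [hi, ite_smul, mul_ite]
    rw [h2, LinearMap.sum_apply, ← Finset.sum_sub_distrib]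
    refine sum_mem fun B _ => ?_
    rw [Module.End.mul_apply, mulX_apply, ← mul_sub]
    exact X_mul_mem_degLT (hd _ n p hp) B
  · intro A u k
    rw [Omega_mul_gen, map_sum]
    simp only [LinearMap.sum_apply]
    rw [Finset.sum_comm]
    refine Finset.sum_congr rfl fun B _ => ?_
    have hT := coeff_map_series ((setZetaZero.toAddMonoidHom.comp
      (substZ Z u).toAddMonoidHom).comp zetaFun.toAddMonoidHom) ?_ k (Z.ψ A B)
    · rw [PowerSeries.coeff_mul_C, mul_comm]
      refine (congrArg (X B * ·) hT).trans ?_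
      rw [Finset.mul_sum, ← Finset.Nat.sum_antidiagonal_swap]
      refine Finset.sum_congr rfl fun x _ => ?_
      rw [Module.End.mul_apply, mulX_apply]
      exact congrArg _ (h _ u _)
    · intro F
      have e : zetaFun (PowerSeries.X * F) = (PowerSeries.X : PowerSeries ℝ) • zetaFun F := by
        rw [X_series_smul, map_mul]
        simp [zetaFun]
      change setZetaZero (substZ Z u (zetaFun (PowerSeries.X * F))) = PowerSeries.X *
        setZetaZero (substZ Z u (zetaFun F))
      rw [e, map_smul, setZetaZero_smul, X_series_smul]
  · intro A u
    simp only [h0, LinearMap.sum_apply, Module.End.mul_apply, mulX_apply]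
    rw [Finset.sum_eq_single A]
    · rw [if_pos rfl, ← h, map_one, map_one]
      rfl
    · intro B _ hB
      rw [if_neg hB.symm, ← h]
      simp
    · simp

end RightMul

/-! ### The map `Ω` is triangular with respect to the degree -/

section Triangular

variable {ι : Type*} [Fintype ι] [DecidableEq ι]
variable {𝔤 : Type*} [LieRing 𝔤] [LieAlgebra ℝ 𝔤] {b : Module.Basis ι ℝ 𝔤}

/-- The ring structure whose underlying semiring is that of the enveloping algebra. -/
instance envAlgRing (b : Module.Basis ι ℝ 𝔤) : Ring (EnvAlg b) :=
  Algebra.semiringToRing (PowerSeries ℝ)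

instance envAlgSub (b : Module.Basis ι ℝ 𝔤) : Sub (EnvAlg b) := (envAlgRing b).toSub

/-- The product of generators along a word. -/
def wordProd (b : Module.Basis ι ℝ 𝔤) (I : List ι) : EnvAlg b := (I.map (gen b)).prod

theorem wordProd_nil : wordProd b [] = 1 := rfl

theorem wordProd_cons (A : ι) (I : List ι) : wordProd b (A :: I) = gen b A * wordProd b I := by
  simp [wordProd]

/-- The exponent vector of a word. -/
def wordExp (I : List ι) : ι →₀ ℕ := Multiset.toFinsupp (I : Multiset ι)

theorem wordExp_concat (I : List ι) (A : ι) :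
    wordExp (I ++ [A]) = Finsupp.single A 1 + wordExp I := by
  rw [wordExp, ← Multiset.coe_add, map_add, Multiset.coe_singleton,
    Multiset.toFinsupp_singleton, add_comm]
  rfl

theorem degree_wordExp (I : List ι) : (wordExp I).degree = I.length := by
  induction I using List.reverseRecOn with
  | nil => simp [wordExp]
  | append_singleton I A ih =>
    rw [wordExp_concat, map_add, ih, Finsupp.degree_single, List.length_append, add_comm]
    rfl

theorem monomial_mem_degLT (α : ι →₀ ℕ) {n : ℕ} (h : α.degree < n) :
    (monomial α 1 : MvPolynomial ι ℝ) ∈ degLT ι n := by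
  intro β hβ
  rw [coeff_monomial, if_neg]
  rintro rfl
  omega

/-- Each further generator multiplies by its variable at order zero, up to terms that do not raise
the degree. The bound is the same at all orders in `λ`, which is what makes `Ω` triangular in the
degree. -/
theorem coeff_Omega_wordProd (Z : LeftInvariantFrame b) (I : List ι) (k : ℕ) :
    PowerSeries.coeff k (Omega Z (wordProd b I)) -
      (if k = 0 then monomial (wordExp I) 1 else 0) ∈ degLT ι I.length := by
  obtain ⟨R, -, hd, hR, -⟩ := exists_rightMul Z
  induction I using List.reverseRecOn generalizing k with
  | nil =>
    rw [wordProd_nil, Omega_one, PowerSeries.coeff_one]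
    have : (monomial (wordExp ([] : List ι)) 1 : MvPolynomial ι ℝ) = 1 := by simp [wordExp]
    rw [this, sub_self]
    exact zero_mem _
  | append_singleton I A ih =>
    have hF : ∀ j, PowerSeries.coeff j (Omega Z (wordProd b I)) ∈ degLT ι (I.length + 1) := by
      intro j
      rw [← sub_add_cancel (PowerSeries.coeff j (Omega Z (wordProd b I)))
        (if j = 0 then monomial (wordExp I) 1 else 0)]
      refine add_mem (degLT_mono (Nat.le_succ _) (ih j)) ?_
      split_ifs
      · exact monomial_mem_degLT _ (by rw [degree_wordExp]; omega)
      · exact zero_mem _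
    have e : wordProd b (I ++ [A]) = wordProd b I * gen b A := by simp [wordProd]
    have h1 : ∑ x ∈ antidiagonal k, (if x.1 = 0 then
        X A * PowerSeries.coeff x.2 (Omega Z (wordProd b I)) else 0) =
        X A * PowerSeries.coeff k (Omega Z (wordProd b I)) := by
      rw [Finset.sum_eq_single (0, k)]
      · simp
      · rintro ⟨i, j⟩ hx hne
        rw [mem_antidiagonal] at hx
        refine if_neg fun h => hne ?_
        simp only at h hx
        rw [Prod.mk.injEq]
        omega
      · intro h
        exact absurd (by simp) h
    have h2 : (if k = 0 then monomial (wordExp (I ++ [A])) 1 else 0 : MvPolynomial ι ℝ) =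
        X A * (if k = 0 then monomial (wordExp I) 1 else 0) := by
      rw [wordExp_concat, mul_ite, mul_zero, X, monomial_mul, one_mul]
    rw [e, hR, h2, List.length_append, List.length_singleton, ← sub_add_sub_cancel _
      (X A * PowerSeries.coeff k (Omega Z (wordProd b I))), ← mul_sub, ← h1,
      ← Finset.sum_sub_distrib]
    exact add_mem (sum_mem fun x _ => hd A x.1 I.length _ (hF x.2)) (X_mul_mem_degLT (ih k) A)

/-- The coefficient of a monomial in `z`, as a series in `λ`. -/
def zCoeff (β : ι →₀ ℕ) : PowerSeries (MvPolynomial ι ℝ) →ₗ[PowerSeries ℝ] PowerSeries ℝ where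
  toFun F := PowerSeries.mk fun k => coeff β (PowerSeries.coeff k F)
  map_add' F G := by ext k; simp
  map_smul' r F := by
    ext k
    rw [RingHom.id_apply, smul_eq_mul, PowerSeries.coeff_mul, PowerSeries.coeff_mk,
      coeff_series_smul, coeff_sum]
    simp

theorem coeff_zCoeff (β : ι →₀ ℕ) (F : PowerSeries (MvPolynomial ι ℝ)) (k : ℕ) :
    PowerSeries.coeff k (zCoeff β F) = coeff β (PowerSeries.coeff k F) := by
  simp [zCoeff]

theorem zCoeff_Omega_wordProd (Z : LeftInvariantFrame b) (I : List ι) (β : ι →₀ ℕ)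
    (h : I.length ≤ β.degree) :
    zCoeff β (Omega Z (wordProd b I)) = if β = wordExp I then 1 else 0 := by
  ext k
  have := coeff_Omega_wordProd Z I k β h
  rw [coeff_sub, sub_eq_zero] at this
  rw [coeff_zCoeff, this]
  simp only [apply_ite (coeff β), coeff_monomial, coeff_zero, apply_ite (PowerSeries.coeff k),
    PowerSeries.coeff_one, map_zero, eq_comm (a := β)]
  split_ifs <;> rfl

/-- The span of the products of fewer than `n` generators. -/
def envSpan (b : Module.Basis ι ℝ 𝔤) (n : ℕ) : Submodule (PowerSeries ℝ) (EnvAlg b) :=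
  Submodule.span (PowerSeries ℝ) {u | ∃ I : List ι, I.length < n ∧ u = wordProd b I}

theorem wordProd_mem_envSpan (I : List ι) {n : ℕ} (h : I.length < n) :
    wordProd b I ∈ envSpan b n := Submodule.subset_span ⟨I, h, rfl⟩

theorem envSpan_mono {m n : ℕ} (h : m ≤ n) : envSpan b m ≤ envSpan b n := by
  refine Submodule.span_mono ?_
  rintro _ ⟨I, hI, rfl⟩
  exact ⟨I, hI.trans_le h, rfl⟩

theorem gen_mul_mem_envSpan (A : ι) {n : ℕ} {u : EnvAlg b} (hu : u ∈ envSpan b n) :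
    gen b A * u ∈ envSpan b (n + 1) := by
  induction hu using Submodule.span_induction with
  | mem x hx =>
    obtain ⟨I, hI, rfl⟩ := hx
    rw [← wordProd_cons]
    exact wordProd_mem_envSpan _ (by simpa using hI)
  | zero => rw [mul_zero]; exact zero_mem _
  | add x y _ _ hx hy => rw [mul_add]; exact add_mem hx hy
  | smul r x _ hx => rw [mul_smul_comm]; exact Submodule.smul_mem _ _ hx

theorem exists_mem_envSpan (u : EnvAlg b) : ∃ n, u ∈ envSpan b n := by
  -- Allowing an arbitrary right factor `v` lets the induction pass through products.
  suffices h : ∀ n, ∀ v ∈ envSpan b n, ∃ m, u * v ∈ envSpan b m by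
    simpa using h 1 1 (wordProd_mem_envSpan [] Nat.one_pos)
  induction u using envAlg_induction with
  | scalar r =>
    intro n v hv
    rw [← Algebra.smul_def]
    exact ⟨n, Submodule.smul_mem _ _ hv⟩
  | gen A => exact fun n v hv => ⟨n + 1, gen_mul_mem_envSpan A hv⟩
  | mul u w hu hw =>
    intro n v hv
    obtain ⟨m, hm⟩ := hw n v hv
    obtain ⟨k, hk⟩ := hu m _ hm
    exact ⟨k, by rwa [mul_assoc]⟩
  | add u w hu hw =>
    intro n v hv
    obtain ⟨m, hm⟩ := hu n v hv
    obtain ⟨k, hk⟩ := hw n v hv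
    exact ⟨max m k, by
      rw [add_mul]
      exact add_mem (envSpan_mono (le_max_left m k) hm) (envSpan_mono (le_max_right m k) hk)⟩

/-- The spanning half of Poincaré–Birkhoff–Witt: interchanging neighbouring generators costs only
shorter words. -/
theorem wordProd_sub_mem_envSpan {I J : List ι} (h : I.Perm J) :
    wordProd b I - wordProd b J ∈ envSpan b I.length := by
  induction h with
  | nil => rw [sub_self]; exact zero_mem _
  | cons A _ ih =>
    rw [wordProd_cons, wordProd_cons, ← mul_sub]
    exact gen_mul_mem_envSpan A ih
  | swap A B I =>
    simp only [wordProd_cons, ← mul_assoc]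
    rw [gen_mul_gen, add_mul, add_sub_cancel_left, Finset.sum_mul]
    refine sum_mem fun C _ => ?_
    rw [smul_mul_assoc, ← wordProd_cons]
    exact Submodule.smul_mem _ _ (wordProd_mem_envSpan _ (by simp))
  | trans h1 _ ih1 ih2 =>
    rw [← h1.length_eq] at ih2
    rw [← sub_add_sub_cancel]
    exact add_mem ih1 ih2

/-- A product of generators with given exponents. -/
def orderedProd (b : Module.Basis ι ℝ 𝔤) (α : ι →₀ ℕ) : EnvAlg b :=
  wordProd b (Finsupp.toMultiset α).toList

theorem wordExp_toList (α : ι →₀ ℕ) : wordExp (Finsupp.toMultiset α).toList = α := by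
  rw [wordExp, Multiset.coe_toList, Finsupp.toMultiset_toFinsupp]

theorem length_toList (α : ι →₀ ℕ) : (Finsupp.toMultiset α).toList.length = α.degree := by
  rw [← degree_wordExp, wordExp_toList]

theorem wordProd_sub_orderedProd_mem (I : List ι) :
    wordProd b I - orderedProd b (wordExp I) ∈ envSpan b I.length := by
  refine wordProd_sub_mem_envSpan ?_
  rw [← Multiset.coe_eq_coe, Multiset.coe_toList, wordExp, Multiset.toFinsupp_toMultiset]

theorem exists_sub_mem_envSpan {n : ℕ} {x : EnvAlg b} (hx : x ∈ envSpan b (n + 1)) :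
    ∃ c ∈ Finsupp.supported (PowerSeries ℝ) (PowerSeries ℝ) {α : ι →₀ ℕ | α.degree = n},
      x - Finsupp.linearCombination (PowerSeries ℝ) (orderedProd b) c ∈ envSpan b n := by
  induction hx using Submodule.span_induction with
  | mem x hx =>
    obtain ⟨I, hI, rfl⟩ := hx
    rcases Nat.lt_succ_iff_lt_or_eq.1 hI with h | h
    · exact ⟨0, zero_mem _, by simpa using wordProd_mem_envSpan (b := b) I h⟩
    · refine ⟨Finsupp.single (wordExp I) 1, Finsupp.single_mem_supported _ _ ?_, ?_⟩
      · simp [degree_wordExp, h]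
      · rw [Finsupp.linearCombination_single, one_smul, ← h]
        exact wordProd_sub_orderedProd_mem I
  | zero => exact ⟨0, zero_mem _, by simp⟩
  | add x y _ _ hx hy =>
    obtain ⟨c, hc, h⟩ := hx
    obtain ⟨d, hd, h'⟩ := hy
    refine ⟨c + d, add_mem hc hd, ?_⟩
    rw [map_add, add_sub_add_comm]
    exact add_mem h h'
  | smul r x _ hx =>
    obtain ⟨c, hc, h⟩ := hx
    refine ⟨r • c, Submodule.smul_mem _ _ hc, ?_⟩
    rw [map_smul, ← smul_sub]
    exact Submodule.smul_mem _ _ h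

theorem zCoeff_Omega_linearCombination (Z : LeftInvariantFrame b) {n : ℕ}
    {c : (ι →₀ ℕ) →₀ PowerSeries ℝ}
    (hc : c ∈ Finsupp.supported (PowerSeries ℝ) (PowerSeries ℝ) {α : ι →₀ ℕ | α.degree = n})
    {β : ι →₀ ℕ} (hβ : n ≤ β.degree) :
    zCoeff β (Omega Z (Finsupp.linearCombination (PowerSeries ℝ) (orderedProd b) c)) = c β := by
  rw [← omegaLin_apply, Finsupp.linearCombination_apply, Finsupp.sum, map_sum, map_sum]
  have h : ∀ α ∈ c.support, zCoeff β (omegaLin Z (c α • orderedProd b α)) =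
      if β = α then c α else 0 := by
    intro α hα
    have hα' : α.degree = n := (Finsupp.mem_supported _ _).1 hc hα
    rw [map_smul, map_smul, omegaLin_apply, orderedProd, zCoeff_Omega_wordProd _ _ _
      (by rw [length_toList]; omega), wordExp_toList, smul_eq_mul, mul_ite, mul_one, mul_zero]
  rw [Finset.sum_congr rfl h, Finset.sum_ite_eq]
  split_ifs with h
  · rfl
  · rw [Finsupp.notMem_support_iff.1 h]

theorem zCoeff_Omega_envSpan (Z : LeftInvariantFrame b) {n : ℕ} {x : EnvAlg b}
    (hx : x ∈ envSpan b n) {β : ι →₀ ℕ} (hβ : n ≤ β.degree) : zCoeff β (Omega Z x) = 0 := by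
  induction hx using Submodule.span_induction with
  | mem x hx =>
    obtain ⟨I, hI, rfl⟩ := hx
    rw [zCoeff_Omega_wordProd _ _ _ (by omega), if_neg]
    rintro rfl
    rw [degree_wordExp] at hβ
    omega
  | zero => rw [← omegaLin_apply, map_zero, map_zero]
  | add x y _ _ hx hy => rw [Omega_add, map_add, hx, hy, add_zero]
  | smul r x _ hx => rw [Omega_smul, map_smul, hx, smul_zero]

/-- The top-degree coefficients of an element can be read off from its image, so they vanish on the
kernel and the filtration degree drops to zero. -/
theorem Omega_injective (Z : LeftInvariantFrame b) : Function.Injective (Omega Z) := by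
  have h : ∀ n, ∀ x ∈ envSpan b n, Omega Z x = 0 → x = 0 := by
    intro n
    induction n with
    | zero =>
      intro x hx _
      simpa [envSpan] using hx
    | succ n ih =>
      intro x hx h0
      refine ih x ?_ h0
      obtain ⟨c, hc, h⟩ := exists_sub_mem_envSpan hx
      have hc0 : c = 0 := by
        ext1 β
        rw [Finsupp.zero_apply]
        by_cases hβ : β.degree = n
        · have := zCoeff_Omega_envSpan Z h hβ.ge
          rw [← omegaLin_apply, map_sub, omegaLin_apply, omegaLin_apply, h0, map_sub, map_zero,
            zCoeff_Omega_linearCombination Z hc hβ.ge, zero_sub, neg_eq_zero] at this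
          exact this
        · by_contra hne
          exact hβ ((Finsupp.mem_supported _ _).1 hc (Finsupp.mem_support_iff.2 hne))
      rwa [hc0, map_zero, sub_zero] at h
  intro x y hxy
  obtain ⟨n, hn⟩ := exists_mem_envSpan (x - y)
  refine sub_eq_zero.1 (h n _ hn ?_)
  rw [← omegaLin_apply, map_sub, omegaLin_apply, omegaLin_apply, hxy, sub_self]

/-- Subtracting the image of the ordered products with the same top coefficients lowers the degree.
The bound `n` must be uniform in the order in `λ`, so that finitely many products with coefficients
in `ℝ⟦λ⟧` suffice. -/
theorem exists_Omega_eq (Z : LeftInvariantFrame b) (n : ℕ) (F : PowerSeries (MvPolynomial ι ℝ))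
    (hF : ∀ β : ι →₀ ℕ, n ≤ β.degree → zCoeff β F = 0) : ∃ u, Omega Z u = F := by
  induction n generalizing F with
  | zero =>
    refine ⟨0, ?_⟩
    rw [← omegaLin_apply, map_zero]
    ext k β
    rw [← coeff_zCoeff β F, hF β (Nat.zero_le _)]
    simp
  | succ n ih =>
    have hfin := Finsupp.finite_of_degree_eq (σ := ι) n
    set c : (ι →₀ ℕ) →₀ PowerSeries ℝ :=
      Finsupp.onFinset hfin.toFinset (fun α => if α.degree = n then zCoeff α F else 0) (by
        intro α hα
        by_contra h
        exact hα (if_neg (by simpa using h))) with hc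
    have hcs : c ∈ Finsupp.supported (PowerSeries ℝ) (PowerSeries ℝ)
        {α : ι →₀ ℕ | α.degree = n} := by
      rw [Finsupp.mem_supported]
      intro α hα
      by_contra h
      exact Finsupp.mem_support_iff.1 hα (if_neg h)
    obtain ⟨u, hu⟩ := ih (F - Omega Z (Finsupp.linearCombination _ (orderedProd b) c)) (by
      intro β hβ
      rw [map_sub, zCoeff_Omega_linearCombination Z hcs hβ, hc, Finsupp.onFinset_apply]
      split_ifs with h
      · exact sub_self _
      · rw [sub_zero]
        exact hF β (by omega))
    exact ⟨u + Finsupp.linearCombination _ (orderedProd b) c, by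
      rw [Omega_add, hu, sub_add_cancel]⟩

theorem exists_zCoeff_eq_zero (Z : LeftInvariantFrame b) (u : EnvAlg b) :
    ∃ n, ∀ β : ι →₀ ℕ, n ≤ β.degree → zCoeff β (Omega Z u) = 0 := by
  obtain ⟨n, hn⟩ := exists_mem_envSpan u
  exact ⟨n, fun β hβ => zCoeff_Omega_envSpan Z hn hβ⟩

theorem Omega_OmegaInv (Z : LeftInvariantFrame b) (p : MvPolynomial ι ℝ) :
    Omega Z (OmegaInv Z p) = PowerSeries.C p := by
  obtain ⟨n, hn⟩ := exists_mem_degLT p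
  refine Function.invFun_eq (exists_Omega_eq Z n _ fun β hβ => ?_)
  ext k
  rw [coeff_zCoeff, PowerSeries.coeff_C]
  split_ifs
  · simpa using hn β hβ
  · simp

theorem OmegaInv_eq (Z : LeftInvariantFrame b) {p : MvPolynomial ι ℝ} {u : EnvAlg b}
    (h : Omega Z u = PowerSeries.C p) : OmegaInv Z p = u :=
  Omega_injective Z ((Omega_OmegaInv Z p).trans h.symm)

theorem OmegaInv_one (Z : LeftInvariantFrame b) : OmegaInv Z 1 = 1 :=
  OmegaInv_eq Z (by rw [Omega_one, map_one])

theorem OmegaInv_add (Z : LeftInvariantFrame b) (p q : MvPolynomial ι ℝ) :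
    OmegaInv Z (p + q) = OmegaInv Z p + OmegaInv Z q :=
  OmegaInv_eq Z (by rw [Omega_add, Omega_OmegaInv, Omega_OmegaInv, map_add])

theorem OmegaInv_smul (Z : LeftInvariantFrame b) (c : ℝ) (p : MvPolynomial ι ℝ) :
    OmegaInv Z (c • p) = (PowerSeries.C c : PowerSeries ℝ) • OmegaInv Z p := by
  refine OmegaInv_eq Z ?_
  ext1 k
  rw [Omega_smul, Omega_OmegaInv, C_series_smul, PowerSeries.coeff_C, PowerSeries.coeff_C]
  split_ifs <;> simp

theorem OmegaInv_X (Z : LeftInvariantFrame b) (A : ι) : OmegaInv Z (X A) = gen b A := by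
  refine OmegaInv_eq Z ?_
  rw [← one_mul (gen b A), Omega_mul_gen]
  have h : ∀ p : PowerSeries (MvPolynomial ι ℝ), setZetaZero (zetaFun p) =
      PowerSeries.map C (PowerSeries.map constantCoeff p) := by
    intro p
    ext1 k
    rw [coeff_setZetaZero, zetaFun, PowerSeries.coeff_map, PowerSeries.coeff_map,
      PowerSeries.coeff_map]
    generalize PowerSeries.coeff k p = q
    change aeval _ (rename Sum.inl q) = _
    induction q using MvPolynomial.induction_on with
    | C a => simp
    | add p q hp hq => rw [map_add, map_add, hp, hq, map_add, map_add]
    | mul_X p B hp => simp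
  simp only [map_one, Module.End.one_apply, h, Z.counit]
  rw [Finset.sum_eq_single A]
  · simp
  · intro B _ hB; simp [hB.symm]
  · simp

end Triangular

/-! ### The star product of polynomials -/

section PolyStar

variable {ι : Type*} [Fintype ι] [DecidableEq ι]
variable {𝔤 : Type*} [LieRing 𝔤] [LieAlgebra ℝ 𝔤] {b : Module.Basis ι ℝ 𝔤}

/-- Division by `λ` stays inside the algebra, because the shifted series obeys the same degree bound
and so lies in the range of `Ω`. -/
theorem exists_shift (Z : LeftInvariantFrame b) (u : EnvAlg b) :
    ∃ v, u = OmegaInv Z (PowerSeries.coeff 0 (Omega Z u)) +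
      (PowerSeries.X : PowerSeries ℝ) • v ∧
      ∀ k, PowerSeries.coeff k (Omega Z v) = PowerSeries.coeff (k + 1) (Omega Z u) := by
  obtain ⟨n, hn⟩ := exists_zCoeff_eq_zero Z u
  obtain ⟨v, hv⟩ := exists_Omega_eq Z n
    (PowerSeries.mk fun k => PowerSeries.coeff (k + 1) (Omega Z u)) (fun β hβ => by
      ext k
      have := congrArg (PowerSeries.coeff (k + 1)) (hn β hβ)
      rw [coeff_zCoeff] at this
      rw [coeff_zCoeff, PowerSeries.coeff_mk, this]
      simp)
  refine ⟨v, Omega_injective Z ?_, fun k => by rw [hv, PowerSeries.coeff_mk]⟩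
  rw [Omega_add, Omega_OmegaInv, Omega_smul, hv, X_series_smul]
  exact eq_C_add_X_mul _

/-- Repeated division by `λ` reduces `T` to its values on lifts of polynomials. For multiplication
by a fixed element this is the `λ`-bilinear extension of the star product. -/
theorem coeff_Omega_linear (Z : LeftInvariantFrame b)
    (T : EnvAlg b →ₗ[PowerSeries ℝ] EnvAlg b) (k : ℕ) (u : EnvAlg b) :
    PowerSeries.coeff k (Omega Z (T u)) = ∑ x ∈ antidiagonal k,
      PowerSeries.coeff x.1 (Omega Z (T (OmegaInv Z (PowerSeries.coeff x.2 (Omega Z u))))) := by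
  induction k generalizing u with
  | zero =>
    obtain ⟨v, hv, -⟩ := exists_shift Z u
    conv_lhs => rw [hv]
    rw [map_add, map_smul, Omega_add, Omega_smul, X_series_smul]
    simp
  | succ k ih =>
    obtain ⟨v, hv, hs⟩ := exists_shift Z u
    conv_lhs => rw [hv]
    rw [map_add, map_smul, Omega_add, Omega_smul, X_series_smul, map_add,
      PowerSeries.coeff_succ_X_mul, ih, Finset.Nat.antidiagonal_succ']
    simp [hs]

/-- The part of order `λ ^ k` of the star product of polynomials. -/
def starCoeff (Z : LeftInvariantFrame b) (k : ℕ) :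
    MvPolynomial ι ℝ →ₗ[ℝ] Module.End ℝ (MvPolynomial ι ℝ) :=
  LinearMap.mk₂ ℝ (fun p q => PowerSeries.coeff k (polyStar Z p q))
    (fun p p' q => by simp only [polyStar, OmegaInv_add, add_mul, Omega_add, map_add])
    (fun c p q => by simp only [polyStar, OmegaInv_smul, smul_mul_assoc, Omega_smul,
      C_series_smul])
    (fun p q q' => by simp only [polyStar, OmegaInv_add, mul_add, Omega_add, map_add])
    (fun c p q => by simp only [polyStar, OmegaInv_smul, mul_smul_comm, Omega_smul,
      C_series_smul])

theorem starCoeff_apply (Z : LeftInvariantFrame b) (k : ℕ) (p q : MvPolynomial ι ℝ) :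
    starCoeff Z k p q = PowerSeries.coeff k (Omega Z (OmegaInv Z p * OmegaInv Z q)) := rfl

theorem isLieStar_starCoeff (Z : LeftInvariantFrame b) :
    IsLieStar (structureConst b) (starCoeff Z) := by
  obtain ⟨R, hlin, -, hR, hR0⟩ := exists_rightMul Z
  have hX : ∀ k A p, starCoeff Z k p (X A) = R A k p := by
    intro k A p
    rw [starCoeff_apply, OmegaInv_X, hR, Omega_OmegaInv, Finset.sum_eq_single (k, 0)]
    · simp
    · rintro ⟨i, j⟩ hx hne
      rw [mem_antidiagonal] at hx
      rw [PowerSeries.coeff_C, if_neg, map_zero]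
      intro h
      apply hne
      simp only at h hx
      rw [Prod.mk.injEq]
      omega
    · intro h
      exact absurd (by simp) h
  refine ⟨fun k p q r => ?_, fun k p => ?_, fun k p => ?_, fun p A => ?_, fun k A => ?_,
    fun k A B => ?_⟩
  -- Both sides expand the same triple product in the enveloping algebra.
  · have h1 := coeff_Omega_linear Z (LinearMap.mulRight _ (OmegaInv Z r)) k
      (OmegaInv Z p * OmegaInv Z q)
    have h2 := coeff_Omega_linear Z (LinearMap.mulLeft _ (OmegaInv Z p)) k
      (OmegaInv Z q * OmegaInv Z r)
    simp only [LinearMap.mulRight_apply, LinearMap.mulLeft_apply] at h1 h2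
    rw [mul_assoc, h2] at h1
    exact h1.symm
  · rw [starCoeff_apply, OmegaInv_one, one_mul, Omega_OmegaInv, PowerSeries.coeff_C]
  · rw [starCoeff_apply, OmegaInv_one, mul_one, Omega_OmegaInv, PowerSeries.coeff_C]
  · have := hR0 A (OmegaInv Z p)
    rw [Omega_OmegaInv] at this
    rw [hX]
    simpa using this
  · have : (starCoeff Z k).flip (X A) = R A k := LinearMap.ext fun p => hX k A p
    rw [this]
    exact hlin A k
  · rw [starCoeff_apply, starCoeff_apply, OmegaInv_X, OmegaInv_X, gen_mul_gen, Omega_add,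
      map_add, add_sub_cancel_left, ← omegaLin_apply, map_sum, map_sum]
    have h : ∀ D, PowerSeries.coeff k (omegaLin Z ((PowerSeries.X *
        PowerSeries.C (structureConst b A B D) : PowerSeries ℝ) • gen b D)) =
        if k = 1 then structureConst b A B D • X D else 0 := by
      intro D
      rw [map_smul, omegaLin_apply, ← OmegaInv_X Z, Omega_OmegaInv, mul_smul, X_series_smul]
      rcases k with _ | k
      · rw [PowerSeries.coeff_zero_X_mul, if_neg zero_ne_one]
      · rw [PowerSeries.coeff_succ_X_mul, C_series_smul, PowerSeries.coeff_C]
        by_cases hk : k = 0 <;> simp [hk]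
    rw [Finset.sum_congr rfl fun D _ => h D]
    split_ifs <;> simp

end PolyStar

/-! ### The trace property -/

section Trace

variable {ι : Type*} [Fintype ι] [DecidableEq ι]
variable {𝔤 : Type*} [LieRing 𝔤] [LieAlgebra ℝ 𝔤] {b : Module.Basis ι ℝ 𝔤}
variable {𝕜 : Type*} [RCLike 𝕜]

theorem exists_order (Z : LeftInvariantFrame b) (k : ℕ) :
    ∃ N, (∀ p, starCoeff Z k p ∈ diffOp N) ∧ ∀ q, (starCoeff Z k).flip q ∈ diffOp N := by
  obtain ⟨m, hm⟩ := (isLieStar_starCoeff Z).order_left k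
  obtain ⟨n, hn⟩ := (isLieStar_starCoeff Z).order_right k
  exact ⟨max m n, fun p => diffOp_mono (le_max_left m n) (hm p),
    fun q => diffOp_mono (le_max_right m n) (hn q)⟩

theorem integrable_bidiff (Z : LeftInvariantFrame b) (k : ℕ) {f g : (ι → ℝ) → 𝕜}
    (h : JointIntegrable f g) : MeasureTheory.Integrable (bidiff Z k f g) := by
  obtain ⟨N, h1, h2⟩ := exists_order Z k
  -- By definition, `bidiff Z k` is `bidiffExt (starCoeff Z k)`.
  exact integrable_bidiffExt h1 h2 h

theorem integral_bidiff_comm (Z : LeftInvariantFrame b) (hc : ∀ A, adTrace b A = 0) (k : ℕ)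
    {f g : (ι → ℝ) → 𝕜} (hf : ContDiff ℝ ((⊤ : ℕ∞) : WithTop ℕ∞) f)
    (hg : ContDiff ℝ ((⊤ : ℕ∞) : WithTop ℕ∞) g) (h : JointIntegrable f g) :
    ∫ z, bidiff Z k f g z = ∫ z, bidiff Z k g f z := by
  obtain ⟨N, h1, h2⟩ := exists_order Z k
  exact integral_bidiffExt_comm h1 h2
    (fun q => (isLieStar_starCoeff Z).commutator_totalDiv hc k q) hf hg h

theorem coeff_star (Z : LeftInvariantFrame b) (f g : PowerSeries ((ι → ℝ) → 𝕜)) (n : ℕ) :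
    PowerSeries.coeff n (star Z f g) = ∑ x ∈ antidiagonal n, ∑ y ∈ antidiagonal x.2,
      bidiff Z x.1 (PowerSeries.coeff y.1 f) (PowerSeries.coeff y.2 g) := by
  rw [star, PowerSeries.coeff_mk]

theorem isIntegrable_star (Z : LeftInvariantFrame b) {f g : PowerSeries ((ι → ℝ) → 𝕜)}
    (h : JointlyIntegrable f g) : IsIntegrable (star Z f g) := by
  intro n
  rw [coeff_star]
  exact MeasureTheory.integrable_finsetSum' _ fun x _ =>
    MeasureTheory.integrable_finsetSum' _ fun y _ => integrable_bidiff Z _ (h y.1 y.2)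

theorem coeff_invIntegral_star (Z : LeftInvariantFrame b) {f g : PowerSeries ((ι → ℝ) → 𝕜)}
    (h : JointlyIntegrable f g) (n : ℕ) : PowerSeries.coeff n (invIntegral (star Z f g)) =
      ∑ x ∈ antidiagonal n, ∑ y ∈ antidiagonal x.2,
        ∫ z, bidiff Z x.1 (PowerSeries.coeff y.1 f) (PowerSeries.coeff y.2 g) z := by
  rw [invIntegral, PowerSeries.coeff_mk, coeff_star]
  simp only [Finset.sum_apply]
  rw [MeasureTheory.integral_finsetSum _ fun x _ => MeasureTheory.integrable_finsetSum _
    fun y _ => integrable_bidiff Z _ (h y.1 y.2)]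
  exact Finset.sum_congr rfl fun x _ => MeasureTheory.integral_finsetSum _
    fun y _ => integrable_bidiff Z _ (h y.1 y.2)

theorem JointlyIntegrable.symm {f g : PowerSeries ((ι → ℝ) → 𝕜)} (h : JointlyIntegrable f g) :
    JointlyIntegrable g f :=
  fun m n => JointIntegrable.symm (h n m)

end Trace

end

end LieStar

theorem mainTheorem3 {ι : Type*} [Fintype ι] [DecidableEq ι]
    {𝔤 : Type*} [LieRing 𝔤] [LieAlgebra ℝ 𝔤] (b : Module.Basis ι ℝ 𝔤)
    (Z : LieStar.LeftInvariantFrame b) (hc : ∀ A, LieStar.adTrace b A = 0)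
    {𝕜 : Type*} [RCLike 𝕜] (f g : PowerSeries ((ι → ℝ) → 𝕜))
    (hf : LieStar.IsSmooth f) (hg : LieStar.IsSmooth g)
    (hfg : LieStar.JointlyIntegrable f g) :
    LieStar.IsIntegrable (LieStar.star Z f g) ∧ LieStar.IsIntegrable (LieStar.star Z g f) ∧
      LieStar.invIntegral (LieStar.star Z f g) = LieStar.invIntegral (LieStar.star Z g f) := by
  refine ⟨LieStar.isIntegrable_star Z hfg, LieStar.isIntegrable_star Z hfg.symm, ?_⟩
  ext n
  rw [LieStar.coeff_invIntegral_star Z hfg, LieStar.coeff_invIntegral_star Z hfg.symm]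
  refine Finset.sum_congr rfl fun x _ => ?_
  -- The swap pairs each term in `f_i, g_j` with the term in `g_j, f_i` at the same order of the
  -- star product.
  rw [← Finset.Nat.sum_antidiagonal_swap]
  exact Finset.sum_congr rfl fun y _ =>
    LieStar.integral_bidiff_comm Z hc x.1 (hf y.2) (hg y.1) (hfg y.2 y.1)
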